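/- **Theorem.** Let $n\ge 1$. Denote by $H_{n,++}$ the set of positive definite matrices in $\mathbb C^{n\times n}$, and by $H_{n,+,1}\supset H_{n,++,1}$ the sets of positive semidefinite, respectively positive definite, Hermitian $n\times n$ matrices of trace $1$. Let $A_1,\dots,A_k\in\mathbb C^{n\times n}$ and $$Q(X)=\sum_{i=1}^k A_iXA_i^*,\qquad Q'(X)=\sum_{i=1}^k A_i^*XA_i,\qquad \tilde Q(X)=\frac{1}{\operatorname{tr}Q'(X)}\,Q'(X).$$ Assume that $Q$ is a positive quantum channel, that is, $\sum_i A_i^*A_i=I_n$ and $Q(X)\in H_{n,++}$ for every $X\in H_{n,+,1}$. Write $\lambda_1$ and $\lambda_n$ for the largest and the smallest eigenvalue of a matrix with real eigenvalues, and put $$a(Q)=\min_{X\in H_{n,+,1}}\lambda_n(Q(X)),\qquad b(Q)=\max_{X\in H_{n,+,1}}\lambda_1(Q(X)),\qquad \kappa=\frac{b(Q)-a(Q)}{b(Q)+a(Q)}.$$ For $X,Y\in H_{n,++}$ let $\operatorname{dist}(X,Y)=\log\lambda_1(XY^{-1})-\log\lambda_n(XY^{-1})$ (the Hilbert metric on rays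 of positive definite matrices). For a nonzero positive semidefinite $\alpha$ and $X\in H_{n,++}$ let $$D_\alpha(X)=\frac{1}{\operatorname{tr}(X^{-1}\alpha)}\,X^{-1/2}\alpha X^{-1/2},$$ and let $\Phi_{\alpha,\beta}=D_\alpha\circ\tilde Q\circ D_\beta\circ Q$ on $H_{n,+,1}$ and $\Theta=\Phi_{\frac1nI_n,\frac1nI_n}$. Then: 1. $0\le\kappa<1$, the maps $Q$ and $\tilde Q$ send $H_{n,++}$ to itself, and $\operatorname{dist}(Q(X),Q(Y))\le\kappa\operatorname{dist}(X,Y)$ and $\operatorname{dist}(\tilde Q(X),\tilde Q(Y))\le\kappa\operatorname{dist}(X,Y)$ for all $X,Y\in H_{n,++}$. 2. For every $t>0$, $D_{tI_n}$ maps $H_{n,++}$ to itself and $\operatorname{dist}(D_{tI_n}(X),D_{tI_n}(Y))=\operatorname{dist}(X,Y)$ for all $X,Y\in H_{n,++}$. 3. $\Theta$ maps $H_{n,++,1}$ to itself and $\operatorname{dist}(\Theta(X),\Theta(Y))\le\kappa^2\operatorname{dist}(X,Y)$ for all $X,Y\in H_{n,++,1}$. 4. $\Theta$ has a unique fixed point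 $F$ in $H_{n,+,1}$. It is positive definite, it lies in the relative interior of $H_{n,+,1}$, and $\Theta^{\circ m}(X)\to F$ as $m\to\infty$ for every $X\in H_{n,+,1}$. 5. There are $\varepsilon_1,\varepsilon_2>0$ such that the open Frobenius-norm balls $B_1$ and $B_2$ of radii $\varepsilon_1$ and $\varepsilon_2$, centered at $\frac1nI_n$ and $F$ respectively, in the space of Hermitian matrices of trace $1$, are contained in $H_{n,++,1}$, and such that for all $\alpha,\beta\in B_1$ the map $\Phi_{\alpha,\beta}$ has a unique fixed point $U(\alpha,\beta)$ in $H_{n,+,1}$, this fixed point lies in $B_2$, and $\Phi_{\alpha,\beta}^{\circ m}(X)\to U(\alpha,\beta)$ as $m\to\infty$ for every $X\in B_2$. -/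

import Mathlib

open scoped ComplexOrder

namespace QBridge

open scoped MatrixOrder Matrix

noncomputable section

/-- Density matrices: positive semidefinite complex matrices of trace one. -/
def density (n : ℕ) : Set (Matrix (Fin n) (Fin n) ℂ) :=
  {X | X.PosSemidef ∧ X.trace = 1}

/-- Positive definite density matrices. -/
def densityPD (n : ℕ) : Set (Matrix (Fin n) (Fin n) ℂ) :=
  {X | X.PosDef ∧ X.trace = 1}

/-- The completely positive operator `Q(X) = ∑ i, A i * X * (A i)ᴴ`. -/
def Q {n k : ℕ} (A : Fin k → Matrix (Fin n) (Fin n) ℂ) (X : Matrix (Fin n) (Fin n) ℂ) :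
    Matrix (Fin n) (Fin n) ℂ :=
  ∑ i, A i * X * (A i)ᴴ

/-- The dual operator `Q'(X) = ∑ i, (A i)ᴴ * X * A i`. -/
def Qdual {n k : ℕ} (A : Fin k → Matrix (Fin n) (Fin n) ℂ) (X : Matrix (Fin n) (Fin n) ℂ) :
    Matrix (Fin n) (Fin n) ℂ :=
  ∑ i, (A i)ᴴ * X * A i

/-- `Q` is a quantum channel: `∑ i, (A i)ᴴ * A i = I`. -/
def IsChannel {n k : ℕ} (A : Fin k → Matrix (Fin n) (Fin n) ℂ) : Prop :=
  ∑ i, (A i)ᴴ * A i = 1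

/-- `Q` is positive: it sends every density matrix to a positive definite matrix. -/
def IsPositive {n k : ℕ} (A : Fin k → Matrix (Fin n) (Fin n) ℂ) : Prop :=
  ∀ X ∈ density n, (Q A X).PosDef

/-- The largest real eigenvalue of a square complex matrix (used only for matrices all of whose
eigenvalues are real: Hermitian ones, and `X * Y⁻¹` with `X`, `Y` positive definite). -/
def lamMax {n : ℕ} (M : Matrix (Fin n) (Fin n) ℂ) : ℝ := sSup (spectrum ℝ M)

/-- The smallest real eigenvalue of a square complex matrix (used as `lamMax` is). -/
def lamMin {n : ℕ} (M : Matrix (Fin n) (Fin n) ℂ) : ℝ := sInf (spectrum ℝ M)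

/-- `a(Q)`, the minimum of the smallest eigenvalue of `Q(X)` over density matrices `X`. -/
def aConst {n k : ℕ} (A : Fin k → Matrix (Fin n) (Fin n) ℂ) : ℝ :=
  sInf ((fun X => lamMin (Q A X)) '' density n)

/-- `b(Q)`, the maximum of the largest eigenvalue of `Q(X)` over density matrices `X`. -/
def bConst {n k : ℕ} (A : Fin k → Matrix (Fin n) (Fin n) ℂ) : ℝ :=
  sSup ((fun X => lamMax (Q A X)) '' density n)

/-- `κ = (b(Q) - a(Q)) / (b(Q) + a(Q))`. -/
def kappa {n k : ℕ} (A : Fin k → Matrix (Fin n) (Fin n) ℂ) : ℝ :=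
  (bConst A - aConst A) / (bConst A + aConst A)

/-- The Hilbert metric `log λ₁(X Y⁻¹) - log λₙ(X Y⁻¹)` of positive definite matrices. -/
def hilbertDist {n : ℕ} (X Y : Matrix (Fin n) (Fin n) ℂ) : ℝ :=
  Real.log (lamMax (X * Y⁻¹)) - Real.log (lamMin (X * Y⁻¹))

/-- `D_α(X) = (tr (X⁻¹ α))⁻¹ X^(-1/2) α X^(-1/2)`. -/
def D {n : ℕ} (α X : Matrix (Fin n) (Fin n) ℂ) : Matrix (Fin n) (Fin n) ℂ :=
  (X⁻¹ * α).trace⁻¹ • ((CFC.sqrt X)⁻¹ * α * (CFC.sqrt X)⁻¹)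

/-- The normalized dual operator `X ↦ Q'(X) / tr Q'(X)`. -/
def Qtilde {n k : ℕ} (A : Fin k → Matrix (Fin n) (Fin n) ℂ) (X : Matrix (Fin n) (Fin n) ℂ) :
    Matrix (Fin n) (Fin n) ℂ :=
  (Qdual A X).trace⁻¹ • Qdual A X

/-- `Φ_{α,β} = D_α ∘ Q̃ ∘ D_β ∘ Q`. -/
def Phi {n k : ℕ} (A : Fin k → Matrix (Fin n) (Fin n) ℂ) (α β : Matrix (Fin n) (Fin n) ℂ) :
    Matrix (Fin n) (Fin n) ℂ → Matrix (Fin n) (Fin n) ℂ :=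
  D α ∘ Qtilde A ∘ D β ∘ Q A

/-- The uniform density matrix `(1/n) I`. -/
def unif (n : ℕ) : Matrix (Fin n) (Fin n) ℂ := (n : ℂ)⁻¹ • 1

/-- `Θ = Φ_{I/n, I/n}`. -/
def Theta {n k : ℕ} (A : Fin k → Matrix (Fin n) (Fin n) ℂ) :
    Matrix (Fin n) (Fin n) ℂ → Matrix (Fin n) (Fin n) ℂ :=
  Phi A (unif n) (unif n)

open scoped Matrix.Norms.Frobenius in
/-- The open ball for the Frobenius norm in the space of Hermitian matrices of trace one. -/
def frobBall {n : ℕ} (C : Matrix (Fin n) (Fin n) ℂ) (r : ℝ) : Set (Matrix (Fin n) (Fin n) ℂ) :=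
  {X | X.IsHermitian ∧ X.trace = 1 ∧ ‖X - C‖ < r}

end

end QBridge

/-! For positive definite X, Y let m and M be the best constants with mY ≤ X ≤ MY. Since X Y⁻¹ is
similar to Y^(-1/2) X Y^(-1/2), dist(X, Y) = log(M/m) (`exists_hilbertDist_eq`), so every estimate
becomes a comparison in the Loewner order.

Compactness of the density matrices gives a(Q) > 0, hence a tr(X) I ≤ Q(X) ≤ b tr(X) I for X ≥ 0,
and trace duality gives Q' the same bounds. Birkhoff's argument (`hilbertDist_map_le`, with the
scalar inequality `log_ratio_le`) turns such bounds into the contraction factor κ = (b - a)/(b + a)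
< 1. For α = tI the map D_α is inversion up to a scalar, and inversion reverses the order, so it is
an isometry. Thus Θ contracts by κ².

A strict contraction sending all density matrices to positive definite ones has an attracting fixed
point (`exists_fixedPoint`): order bounds along an orbit survive in a limit point, which is
therefore positive definite.

For α near I/n, D_α is no longer an isometry, but its Lipschitz constant is 1 + O(t) on matrices
pinched between fixed multiples of I (`hilbertDist_D_le`). The gain κ² absorbs this loss, so Φ_{α,β}
still contracts by some q < 1. It is also uniformly close to Θ (`hilbertDist_Phi_Theta_le`), so its
fixed point is close to F; comparison with the Frobenius norm turns this into membership in the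
ball. -/

namespace QBridge

open scoped MatrixOrder Matrix
open Matrix Filter Topology

/-! ### Loewner order, operator norm and quadratic forms -/

section Order

variable {n : ℕ}

open scoped Matrix.Norms.L2Operator in
theorem sqrt_le_sqrt_of_le {X Y : Matrix (Fin n) (Fin n) ℂ} (h : X ≤ Y) :
    CFC.sqrt X ≤ CFC.sqrt Y :=
  CFC.sqrt_le_sqrt X Y h

open scoped Matrix.Norms.L2Operator in
theorem orderClosedTopology_matrix : OrderClosedTopology (Matrix (Fin n) (Fin n) ℂ) :=
  inferInstance

/-- Operator monotonicity of the square root; the converse implication fails for noncommuting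
matrices. -/
theorem le_of_sq_le_sq {P R : Matrix (Fin n) (Fin n) ℂ} (hP : 0 ≤ P) (hR : 0 ≤ R)
    (h : P * P ≤ R * R) : P ≤ R := by
  have := sqrt_le_sqrt_of_le h
  rwa [CFC.sqrt_mul_self P hP, CFC.sqrt_mul_self R hR] at this

open scoped Matrix.Norms.L2Operator in
theorem le_smul_one_of_norm_le {H : Matrix (Fin n) (Fin n) ℂ} (hH : H.IsHermitian) {t : ℝ}
    (h : ‖H‖ ≤ t) : H ≤ t • 1 := by
  have h1 := IsSelfAdjoint.le_algebraMap_norm_self (a := H) hH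
  rw [Algebra.algebraMap_eq_smul_one] at h1
  exact h1.trans (smul_le_smul_of_nonneg_right h zero_le_one)

open scoped Matrix.Norms.L2Operator in
theorem neg_smul_one_le_of_norm_le {H : Matrix (Fin n) (Fin n) ℂ} (hH : H.IsHermitian) {t : ℝ}
    (h : ‖H‖ ≤ t) : -(t • 1) ≤ H := by
  have := le_smul_one_of_norm_le (H := -H) hH.neg (t := t) (by rwa [norm_neg])
  exact neg_le.mp this

open scoped Matrix.Norms.L2Operator in
-- The factors tI - H and tI + H are nonnegative and commute, so their product t²I - H² is
-- nonnegative; the C*-identity then bounds ‖H‖².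
theorem norm_le_of_le {H : Matrix (Fin n) (Fin n) ℂ} (hH : H.IsHermitian) {t : ℝ} (ht : 0 ≤ t)
    (h1 : H ≤ t • 1) (h2 : -(t • 1) ≤ H) : ‖H‖ ≤ t := by
  have e : (0 : Matrix (Fin n) (Fin n) ℂ) ≤ (t • 1 - H) * (t • 1 + H) := by
    refine Commute.mul_nonneg (sub_nonneg.2 h1) (by simpa using add_le_add_right h2 (t • 1)) ?_
    rw [commute_iff_eq]
    simp only [sub_mul, mul_add, add_mul, mul_sub, smul_mul_assoc, mul_smul_comm, one_mul, mul_one,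
      smul_add, smul_sub]
    abel
  have e2 : star H * H ≤ algebraMap ℝ _ (t ^ 2) := by
    have hs : star H = H := hH
    rw [hs, Algebra.algebraMap_eq_smul_one, ← sub_nonneg]
    convert e using 1
    simp only [sub_mul, mul_add, smul_mul_assoc, mul_smul_comm, one_mul, mul_one,
      smul_sub, smul_smul, sq]
    abel
  have e3 := (CStarAlgebra.norm_le_iff_le_algebraMap (star H * H) (sq_nonneg t)
    (star_mul_self_nonneg H)).2 e2
  rw [CStarRing.norm_star_mul_self, ← sq] at e3
  exact abs_le_of_sq_le_sq' e3 ht |>.2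

theorem PosDef.of_le {X Y : Matrix (Fin n) (Fin n) ℂ} (hY : Y.PosDef) (h : Y ≤ X) :
    X.PosDef := by
  simpa using hY.add_posSemidef (le_iff.1 h)

theorem posDef_real_smul {X : Matrix (Fin n) (Fin n) ℂ} (hX : X.PosDef) {r : ℝ} (hr : 0 < r) :
    (r • X).PosDef := hX.smul hr

theorem isHermitian_real_smul {X : Matrix (Fin n) (Fin n) ℂ} (hX : X.IsHermitian) (r : ℝ) :
    (r • X).IsHermitian := hX.smul (IsSelfAdjoint.all r)

theorem conjTranspose_mul_mul_le {X Y : Matrix (Fin n) (Fin n) ℂ} (h : X ≤ Y)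
    (B : Matrix (Fin n) (Fin n) ℂ) : Bᴴ * X * B ≤ Bᴴ * Y * B :=
  star_left_conjugate_le_conjugate h B

theorem re_trace_mono {X Y : Matrix (Fin n) (Fin n) ℂ} (h : X ≤ Y) : X.trace.re ≤ Y.trace.re := by
  have := (le_iff.1 h).trace_nonneg
  rw [trace_sub, sub_nonneg] at this
  exact (Complex.le_def.1 this).1

theorem trace_eq_re {X : Matrix (Fin n) (Fin n) ℂ} (h : X.IsHermitian) :
    X.trace = (X.trace.re : ℂ) := by
  have h1 : star X.trace = X.trace := by rw [← trace_conjTranspose, h.eq]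
  exact (Complex.conj_eq_iff_re.1 h1).symm

theorem re_trace_pos (hn : 0 < n) {X : Matrix (Fin n) (Fin n) ℂ} (h : X.PosDef) :
    0 < X.trace.re := by
  have : Nonempty (Fin n) := ⟨⟨0, hn⟩⟩
  exact (Complex.lt_def.1 h.trace_pos).1

/-- The quadratic form of `X`, as a real number. -/
noncomputable def qf (X : Matrix (Fin n) (Fin n) ℂ) (u : Fin n → ℂ) : ℝ :=
  (star u ⬝ᵥ X *ᵥ u).re

theorem qf_sub (X Y : Matrix (Fin n) (Fin n) ℂ) (u : Fin n → ℂ) :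
    qf (X - Y) u = qf X u - qf Y u := by
  simp [qf, sub_mulVec, dotProduct_sub]

theorem qf_smul (r : ℝ) (X : Matrix (Fin n) (Fin n) ℂ) (u : Fin n → ℂ) :
    qf (r • X) u = r * qf X u := by
  simp [qf, smul_mulVec, dotProduct_smul]

theorem nonneg_iff_qf {X : Matrix (Fin n) (Fin n) ℂ} (hX : X.IsHermitian) :
    0 ≤ X ↔ ∀ u, 0 ≤ qf X u := by
  rw [nonneg_iff_posSemidef, posSemidef_iff_dotProduct_mulVec]
  refine ⟨fun h u => (Complex.le_def.1 (h.2 u)).1, fun h => ⟨hX, fun u => ?_⟩⟩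
  exact Complex.le_def.2 ⟨h u, (hX.im_star_dotProduct_mulVec_self u).symm⟩

theorem le_iff_qf {X Y : Matrix (Fin n) (Fin n) ℂ} (hX : X.IsHermitian) (hY : Y.IsHermitian) :
    X ≤ Y ↔ ∀ u, qf X u ≤ qf Y u := by
  rw [← sub_nonneg, nonneg_iff_qf (hY.sub hX)]
  simp [qf_sub]

theorem qf_mono {X Y : Matrix (Fin n) (Fin n) ℂ} (h : X ≤ Y) (u : Fin n → ℂ) :
    qf X u ≤ qf Y u := by
  have := (nonneg_iff_qf (le_iff.1 h).1).1 (sub_nonneg.2 h) u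
  rw [qf_sub] at this; linarith

theorem le_trace_smul_one {X : Matrix (Fin n) (Fin n) ℂ} (hX : 0 ≤ X) :
    X ≤ X.trace.re • 1 := by
  have hH := hX.posSemidef.1
  rw [← Algebra.algebraMap_eq_smul_one, le_algebraMap_iff_spectrum_le (ha := hH)]
  intro x hx
  rw [hH.spectrum_real_eq_range_eigenvalues] at hx
  obtain ⟨i, rfl⟩ := hx
  rw [hH.trace_eq_sum_eigenvalues]
  simp only [Complex.coe_algebraMap, Complex.re_sum, Complex.ofReal_re]
  exact Finset.single_le_sum (f := hH.eigenvalues)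
    (fun j _ => hX.posSemidef.eigenvalues_nonneg j) (Finset.mem_univ i)

theorem le_one_of_trace_eq_one {X : Matrix (Fin n) (Fin n) ℂ} (hX : 0 ≤ X)
    (ht : X.trace.re = 1) : X ≤ 1 := by
  simpa [ht] using le_trace_smul_one hX

/-! ### Extreme eigenvalues as Loewner bounds -/

section Spectrum

variable {Z : Matrix (Fin n) (Fin n) ℂ}

/-- Together with nonemptiness, this makes the `sInf` and `sSup` in `lamMin` and `lamMax` attained
eigenvalues instead of the default value 0. -/
theorem finite_spectrum (hZ : Z.IsHermitian) : (spectrum ℝ Z).Finite := by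
  rw [hZ.spectrum_real_eq_range_eigenvalues]
  exact Set.finite_range _

theorem nonempty_spectrum (hn : 0 < n) (hZ : Z.IsHermitian) : (spectrum ℝ Z).Nonempty := by
  rw [hZ.spectrum_real_eq_range_eigenvalues]
  exact ⟨_, ⟨0, hn⟩, rfl⟩

theorem lamMin_smul_one_le (hZ : Z.IsHermitian) : lamMin Z • 1 ≤ Z := by
  rw [← Algebra.algebraMap_eq_smul_one, algebraMap_le_iff_le_spectrum (ha := hZ)]
  exact fun x hx => csInf_le (finite_spectrum hZ).bddBelow hx

theorem le_lamMax_smul_one (hZ : Z.IsHermitian) : Z ≤ lamMax Z • 1 := by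
  rw [← Algebra.algebraMap_eq_smul_one, le_algebraMap_iff_spectrum_le (ha := hZ)]
  exact fun x hx => le_csSup (finite_spectrum hZ).bddAbove hx

theorem le_lamMin (hn : 0 < n) (hZ : Z.IsHermitian) {m : ℝ} (h : m • 1 ≤ Z) : m ≤ lamMin Z := by
  rw [← Algebra.algebraMap_eq_smul_one, algebraMap_le_iff_le_spectrum (ha := hZ)] at h
  exact le_csInf (nonempty_spectrum hn hZ) h

theorem lamMax_le (hn : 0 < n) (hZ : Z.IsHermitian) {m : ℝ} (h : Z ≤ m • 1) : lamMax Z ≤ m := by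
  rw [← Algebra.algebraMap_eq_smul_one, le_algebraMap_iff_spectrum_le (ha := hZ)] at h
  exact csSup_le (nonempty_spectrum hn hZ) h

theorem lamMin_pos (hn : 0 < n) (hZ : Z.PosDef) : 0 < lamMin Z := by
  have h := (nonempty_spectrum hn hZ.isHermitian).csInf_mem (finite_spectrum hZ.isHermitian)
  change lamMin Z ∈ _ at h
  rw [hZ.isHermitian.spectrum_real_eq_range_eigenvalues] at h
  obtain ⟨i, hi⟩ := h
  rw [← hi]
  exact hZ.eigenvalues_pos i

theorem lamMin_le_lamMax (hn : 0 < n) (hZ : Z.IsHermitian) : lamMin Z ≤ lamMax Z :=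
  csInf_le_csSup (nonempty_spectrum hn hZ) (finite_spectrum hZ).bddBelow
    (finite_spectrum hZ).bddAbove

end Spectrum

/-! ### The Hilbert metric through Loewner comparisons -/

section Relative

variable {X Y : Matrix (Fin n) (Fin n) ℂ}

theorem posDef_sqrt (hY : Y.PosDef) : (CFC.sqrt Y).PosDef :=
  (hY.isStrictlyPositive.sqrt).posDef

/-- `X * Y⁻¹` is similar to a positive definite matrix that carries the order relation between
`X` and the multiples of `Y`. -/
theorem exists_similar (hX : X.PosDef) (hY : Y.PosDef) :
    ∃ Z : Matrix (Fin n) (Fin n) ℂ, Z.PosDef ∧ spectrum ℝ (X * Y⁻¹) = spectrum ℝ Z ∧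
      (∀ m : ℝ, m • Y ≤ X ↔ m • 1 ≤ Z) ∧ ∀ m : ℝ, X ≤ m • Y ↔ Z ≤ m • 1 := by
  set P := CFC.sqrt Y with hP
  have hPd : P.PosDef := posDef_sqrt hY
  have hPP : P * P = Y := CFC.sqrt_mul_sqrt_self Y hY.posSemidef.nonneg
  have hu := hPd.isUnit
  have hdet := (isUnit_iff_isUnit_det P).1 hu
  have h1 : P * P⁻¹ = 1 := mul_nonsing_inv P hdet
  have h2 : P⁻¹ * P = 1 := nonsing_inv_mul P hdet
  have hPH : Pᴴ = P := hPd.isHermitian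
  have hPiH : (P⁻¹)ᴴ = P⁻¹ := hPd.inv.isHermitian
  have hYi : P⁻¹ * Y * P⁻¹ = 1 := by
    rw [← hPP, ← mul_assoc, h2, one_mul, h1]
  have hXi : P * (P⁻¹ * X * P⁻¹) * P = X := by
    rw [← mul_assoc, ← mul_assoc, h1, one_mul, mul_assoc, h2, mul_one]
  refine ⟨P⁻¹ * X * P⁻¹, ?_, ?_, fun m => ⟨fun h => ?_, fun h => ?_⟩,
    fun m => ⟨fun h => ?_, fun h => ?_⟩⟩
  · have := (IsUnit.posDef_star_left_conjugate_iff hPd.inv.isUnit (x := X)).2 hX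
    rwa [star_eq_conjTranspose, hPiH] at this
  · have e : X * Y⁻¹ = hu.unit * (P⁻¹ * X * P⁻¹) * (hu.unit⁻¹ : (Matrix (Fin n) (Fin n) ℂ)ˣ) := by
      have : ((hu.unit⁻¹ : (Matrix (Fin n) (Fin n) ℂ)ˣ) : Matrix (Fin n) (Fin n) ℂ) = P⁻¹ := by
        rw [coe_units_inv, IsUnit.unit_spec]
      rw [this, IsUnit.unit_spec, ← hPP, Matrix.mul_inv_rev, ← mul_assoc, ← mul_assoc, ← mul_assoc, h1,
        one_mul]
    rw [e, spectrum.units_conjugate]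
  · simpa [hPiH, hYi] using conjTranspose_mul_mul_le h P⁻¹
  · simpa [hPH, hXi, hPP] using conjTranspose_mul_mul_le h P
  · simpa [hPiH, hYi] using conjTranspose_mul_mul_le h P⁻¹
  · simpa [hPH, hXi, hPP] using conjTranspose_mul_mul_le h P

/-- The Hilbert distance is the logarithm of the ratio of the two best constants. -/
theorem exists_hilbertDist_eq (hn : 0 < n) (hX : X.PosDef) (hY : Y.PosDef) :
    ∃ m M : ℝ, 0 < m ∧ m ≤ M ∧ m • Y ≤ X ∧ X ≤ M • Y ∧
      hilbertDist X Y = Real.log M - Real.log m := by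
  obtain ⟨Z, hZ, hs, h1, h2⟩ := exists_similar hX hY
  refine ⟨lamMin Z, lamMax Z, lamMin_pos hn hZ, lamMin_le_lamMax hn hZ.isHermitian,
    (h1 _).2 (lamMin_smul_one_le hZ.isHermitian), (h2 _).2 (le_lamMax_smul_one hZ.isHermitian), ?_⟩
  simp only [hilbertDist, lamMin, lamMax, hs]

/-- The extreme eigenvalues of the similar matrix Z are the optimal constants, so any other
admissible pair is looser. Upper bounds on distances are derived from this form. -/
theorem hilbertDist_le (hn : 0 < n) (hX : X.PosDef) (hY : Y.PosDef) {m M : ℝ} (hm : 0 < m)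
    (h1 : m • Y ≤ X) (h2 : X ≤ M • Y) : hilbertDist X Y ≤ Real.log M - Real.log m := by
  obtain ⟨Z, hZ, hs, hl, hu⟩ := exists_similar hX hY
  have e1 := le_lamMin hn hZ.isHermitian ((hl _).1 h1)
  have e2 := lamMax_le hn hZ.isHermitian ((hu _).1 h2)
  have e3 := lamMin_pos hn hZ
  have e4 := lamMin_le_lamMax hn hZ.isHermitian
  have : hilbertDist X Y = Real.log (lamMax Z) - Real.log (lamMin Z) := by
    simp only [hilbertDist, lamMin, lamMax, hs]
  rw [this]
  exact sub_le_sub (Real.log_le_log (by linarith) e2) (Real.log_le_log hm e1)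

theorem hilbertDist_nonneg (hn : 0 < n) (hX : X.PosDef) (hY : Y.PosDef) : 0 ≤ hilbertDist X Y := by
  obtain ⟨m, M, hm, hmM, -, -, h⟩ := exists_hilbertDist_eq hn hX hY
  rw [h, sub_nonneg]
  exact Real.log_le_log hm hmM

theorem inv_smul_le_of_le_smul {r : ℝ} (hr : 0 < r) (h : X ≤ r • Y) : r⁻¹ • X ≤ Y := by
  have := smul_le_smul_of_nonneg_left h (inv_nonneg.2 hr.le)
  rwa [smul_smul, inv_mul_cancel₀ hr.ne', one_smul] at this

theorem le_inv_smul_of_smul_le {r : ℝ} (hr : 0 < r) (h : r • Y ≤ X) : Y ≤ r⁻¹ • X := by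
  have := smul_le_smul_of_nonneg_left h (inv_nonneg.2 hr.le)
  rwa [smul_smul, inv_mul_cancel₀ hr.ne', one_smul] at this

theorem hilbertDist_comm (hn : 0 < n) (hX : X.PosDef) (hY : Y.PosDef) :
    hilbertDist X Y = hilbertDist Y X := by
  have key : ∀ {X Y : Matrix (Fin n) (Fin n) ℂ}, X.PosDef → Y.PosDef →
      hilbertDist Y X ≤ hilbertDist X Y := by
    intro X Y hX hY
    obtain ⟨m, M, hm, hmM, h1, h2, h⟩ := exists_hilbertDist_eq hn hX hY
    have := hilbertDist_le hn hY hX (inv_pos.2 (hm.trans_le hmM))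
      (inv_smul_le_of_le_smul (hm.trans_le hmM) h2) (le_inv_smul_of_smul_le hm h1)
    rw [Real.log_inv, Real.log_inv] at this
    linarith
  exact le_antisymm (key hY hX) (key hX hY)

theorem hilbertDist_triangle (hn : 0 < n) {W : Matrix (Fin n) (Fin n) ℂ} (hX : X.PosDef)
    (hY : Y.PosDef) (hW : W.PosDef) :
    hilbertDist X W ≤ hilbertDist X Y + hilbertDist Y W := by
  obtain ⟨m, M, hm, hmM, h1, h2, h⟩ := exists_hilbertDist_eq hn hX hY
  obtain ⟨m', M', hm', hmM', h1', h2', h'⟩ := exists_hilbertDist_eq hn hY hW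
  have hM := hm.trans_le hmM
  have hM' := hm'.trans_le hmM'
  have := hilbertDist_le hn hX hW (mul_pos hm hm') (M := M * M')
    (by rw [mul_smul]; exact (smul_le_smul_of_nonneg_left h1' hm.le).trans h1)
    (by rw [mul_smul]; exact h2.trans (smul_le_smul_of_nonneg_left h2' hM.le))
  rw [Real.log_mul hM.ne' hM'.ne', Real.log_mul hm.ne' hm'.ne'] at this
  linarith

theorem hilbertDist_smul_left_le (hn : 0 < n) (hX : X.PosDef) (hY : Y.PosDef) {r : ℝ}
    (hr : 0 < r) : hilbertDist (r • X) Y ≤ hilbertDist X Y := by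
  obtain ⟨m, M, hm, hmM, h1, h2, h⟩ := exists_hilbertDist_eq hn hX hY
  have := hilbertDist_le hn (posDef_real_smul hX hr) hY (mul_pos hr hm) (M := r * M)
    (by rw [mul_smul]; exact smul_le_smul_of_nonneg_left h1 hr.le)
    (by rw [mul_smul]; exact smul_le_smul_of_nonneg_left h2 hr.le)
  rw [Real.log_mul hr.ne' (hm.trans_le hmM).ne', Real.log_mul hr.ne' hm.ne'] at this
  linarith

theorem hilbertDist_smul_left (hn : 0 < n) (hX : X.PosDef) (hY : Y.PosDef) {r : ℝ}
    (hr : 0 < r) : hilbertDist (r • X) Y = hilbertDist X Y := by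
  refine le_antisymm (hilbertDist_smul_left_le hn hX hY hr) ?_
  have := hilbertDist_smul_left_le hn (posDef_real_smul hX hr) hY (inv_pos.2 hr)
  rwa [smul_smul, inv_mul_cancel₀ hr.ne', one_smul] at this

theorem hilbertDist_smul_right (hn : 0 < n) (hX : X.PosDef) (hY : Y.PosDef) {r : ℝ}
    (hr : 0 < r) : hilbertDist X (r • Y) = hilbertDist X Y := by
  rw [hilbertDist_comm hn hX (posDef_real_smul hY hr), hilbertDist_smul_left hn hY hX hr,
    hilbertDist_comm hn hY hX]

open scoped Matrix.Norms.L2Operator in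
theorem inv_le_inv_of_le (hX : X.PosDef) (h : X ≤ Y) : Y⁻¹ ≤ X⁻¹ := by
  have hY := PosDef.of_le hX h
  have := CStarAlgebra.inv_le_inv (a := hX.isUnit.unit) (b := hY.isUnit.unit)
    hX.posSemidef.nonneg h
  rwa [coe_units_inv, coe_units_inv, IsUnit.unit_spec, IsUnit.unit_spec] at this

theorem inv_real_smul {r : ℝ} (hr : r ≠ 0) (hX : X.PosDef) : (r • X)⁻¹ = r⁻¹ • X⁻¹ := by
  refine inv_eq_left_inv ?_
  rw [smul_mul_smul_comm, inv_mul_cancel₀ hr, one_smul,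
    nonsing_inv_mul _ ((isUnit_iff_isUnit_det X).1 hX.isUnit)]

/-- Inversion reverses the order, so the constants (m, M) become (1/M, 1/m), with the same ratio. -/
theorem hilbertDist_inv_le (hn : 0 < n) (hX : X.PosDef) (hY : Y.PosDef) :
    hilbertDist X⁻¹ Y⁻¹ ≤ hilbertDist X Y := by
  obtain ⟨m, M, hm, hmM, h1, h2, h⟩ := exists_hilbertDist_eq hn hX hY
  have hM := hm.trans_le hmM
  have e1 := inv_le_inv_of_le (posDef_real_smul hY hm) h1
  have e2 := inv_le_inv_of_le hX h2
  rw [inv_real_smul hm.ne' hY] at e1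
  rw [inv_real_smul hM.ne' hY] at e2
  have := hilbertDist_le hn hX.inv hY.inv (inv_pos.2 hM) e2 e1
  rw [Real.log_inv, Real.log_inv] at this
  linarith

theorem hilbertDist_inv (hn : 0 < n) (hX : X.PosDef) (hY : Y.PosDef) :
    hilbertDist X⁻¹ Y⁻¹ = hilbertDist X Y := by
  refine le_antisymm (hilbertDist_inv_le hn hX hY) ?_
  have := hilbertDist_inv_le hn hX.inv hY.inv
  rwa [nonsing_inv_nonsing_inv _ ((isUnit_iff_isUnit_det X).1 hX.isUnit),
    nonsing_inv_nonsing_inv _ ((isUnit_iff_isUnit_det Y).1 hY.isUnit)] at this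

end Relative

end Order

/-! ### Birkhoff's contraction theorem -/

section Birkhoff

/-- The scalar inequality behind Birkhoff's contraction theorem. -/
theorem log_ratio_le {a b p r m M : ℝ} (ha : 0 < a) (hab : a ≤ b) (hp : 0 ≤ p) (hr : 0 ≤ r)
    (hpr : 0 < p + r) (hm : 0 < m) (hmM : m ≤ M) :
    Real.log ((M * b * p + m * a * r) / (b * p + a * r)) -
      Real.log ((M * a * p + m * b * r) / (a * p + b * r)) ≤
      (b - a) / (b + a) * (Real.log M - Real.log m) := by
  have hb : 0 < b := ha.trans_le hab
  have pos : ∀ {x y : ℝ}, 0 < x → 0 < y → 0 < x * p + y * r := by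
    intro x y hx hy
    rcases hp.lt_or_eq with h | h
    · have := mul_pos hx h
      have := mul_nonneg hy.le hr
      linarith
    · subst h
      have := mul_pos hy (by linarith : 0 < r)
      linarith
  set κ := (b - a) / (b + a) with hκ
  -- The claim is g(m) ≤ g(M): at x = m the term log m cancels from the two logarithms. So it
  -- suffices that g increases.
  let g : ℝ → ℝ := fun x => κ * Real.log x - Real.log (x * b * p + m * a * r) +
    Real.log (x * a * p + m * b * r)
  have hd : ∀ x, 0 < x → HasDerivAt g (κ * x⁻¹ - b * p / (x * b * p + m * a * r) +
      a * p / (x * a * p + m * b * r)) x := by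
    intro x hx
    have h1 : HasDerivAt (fun x : ℝ => x * b * p + m * a * r) (b * p) x := by
      simpa [mul_assoc] using ((hasDerivAt_id x).mul_const (b * p)).add_const (m * a * r)
    have h2 : HasDerivAt (fun x : ℝ => x * a * p + m * b * r) (a * p) x := by
      simpa [mul_assoc] using ((hasDerivAt_id x).mul_const (a * p)).add_const (m * b * r)
    exact (((Real.hasDerivAt_log hx.ne').const_mul κ).sub
      (h1.log (pos (mul_pos hx hb) (mul_pos hm ha)).ne')).add
      (h2.log (pos (mul_pos hx ha) (mul_pos hm hb)).ne')
  have hmono : MonotoneOn g (Set.Ici m) := by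
    refine monotoneOn_of_deriv_nonneg (convex_Ici m)
      (fun x hx => (hd x (hm.trans_le hx)).continuousAt.continuousWithinAt) ?_ ?_
    · intro x hx
      rw [interior_Ici] at hx
      exact (hd x (hm.trans hx)).differentiableAt.differentiableWithinAt
    · intro x hx
      rw [interior_Ici] at hx
      have hx0 : 0 < x := hm.trans hx
      rw [(hd x hx0).deriv]
      have e1 := pos (mul_pos hx0 hb) (mul_pos hm ha)
      have e2 := pos (mul_pos hx0 ha) (mul_pos hm hb)
      -- The factor κ is what makes the numerator a perfect square, (xp - mr)², whatever the values
      -- of p and r.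
      have e : κ * x⁻¹ - b * p / (x * b * p + m * a * r) + a * p / (x * a * p + m * b * r) =
          (b - a) * (a * b * (x * p - m * r) ^ 2) /
            ((b + a) * x * (x * b * p + m * a * r) * (x * a * p + m * b * r)) := by
        rw [hκ]
        have : b + a ≠ 0 := by positivity
        obtain ⟨d, hd⟩ : ∃ d, d = x * b * p + m * a * r := ⟨_, rfl⟩
        obtain ⟨d', hd'⟩ : ∃ d', d' = x * a * p + m * b * r := ⟨_, rfl⟩
        rw [← hd] at e1 ⊢
        rw [← hd'] at e2 ⊢
        field_simp
        rw [hd, hd']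
        ring
      rw [e]
      have : 0 ≤ b - a := sub_nonneg.2 hab
      positivity
  have key := hmono (Set.mem_Ici.2 le_rfl) (Set.mem_Ici.2 hmM) hmM
  have hM := hm.trans_le hmM
  have f1 : Real.log (m * b * p + m * a * r) = Real.log m + Real.log (b * p + a * r) := by
    rw [← Real.log_mul hm.ne' (pos hb ha).ne']; ring_nf
  have f2 : Real.log (m * a * p + m * b * r) = Real.log m + Real.log (a * p + b * r) := by
    rw [← Real.log_mul hm.ne' (pos ha hb).ne']; ring_nf
  simp only [g, f1, f2] at key
  rw [Real.log_div (pos (mul_pos hM hb) (mul_pos hm ha)).ne' (pos hb ha).ne',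
    Real.log_div (pos (mul_pos hM ha) (mul_pos hm hb)).ne' (pos ha hb).ne']
  linarith

variable {n : ℕ}

/-- Birkhoff's contraction theorem, for a map whose image has bounded eccentricity. -/
theorem hilbertDist_map_le (hn : 0 < n)
    (L : Matrix (Fin n) (Fin n) ℂ →ₗ[ℝ] Matrix (Fin n) (Fin n) ℂ) {a b : ℝ} (ha : 0 < a)
    (hab : a ≤ b) (hl : ∀ X, 0 ≤ X → (a * X.trace.re) • 1 ≤ L X)
    (hu : ∀ X, 0 ≤ X → L X ≤ (b * X.trace.re) • 1)
    {X Y : Matrix (Fin n) (Fin n) ℂ} (hX : X.PosDef) (hY : Y.PosDef) (hLX : (L X).PosDef)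
    (hLY : (L Y).PosDef) :
    hilbertDist (L X) (L Y) ≤ (b - a) / (b + a) * hilbertDist X Y := by
  obtain ⟨m, M, hm, hmM, h1, h2, h⟩ := exists_hilbertDist_eq hn hX hY
  rw [h]
  have hb := ha.trans_le hab
  -- If m = M, the differences P and R below both vanish and the quotients by p and r degenerate,
  -- but then X is a multiple of Y.
  rcases hmM.eq_or_lt with rfl | hlt
  · have e : X = m • Y := le_antisymm h2 h1
    have : L X = m • L Y := by rw [e, map_smul]
    have := hilbertDist_le hn hLX hLY hm this.ge this.le
    simpa using this
  set P := X - m • Y with hP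
  set R := M • Y - X with hR
  have hP0 : 0 ≤ P := sub_nonneg.2 h1
  have hR0 : 0 ≤ R := sub_nonneg.2 h2
  have hp := re_trace_mono hP0
  have hr := re_trace_mono hR0
  rw [trace_zero, Complex.zero_re] at hp hr
  set p := P.trace.re with hpdef
  set r := R.trace.re with hrdef
  have hpr : 0 < p + r := by
    have : p + r = (M - m) * Y.trace.re := by
      rw [hpdef, hrdef, ← Complex.add_re, ← trace_add, hP, hR]
      have : X - m • Y + (M • Y - X) = (M - m) • Y := by rw [sub_smul]; abel
      rw [this, trace_smul, Complex.smul_re, smul_eq_mul]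
    rw [this]
    exact mul_pos (sub_pos.2 hlt) (re_trace_pos hn hY)
  have pos : ∀ {x y : ℝ}, 0 < x → 0 < y → 0 < x * p + y * r := by
    intro x y hx hy
    rcases hp.lt_or_eq with h | h
    · have := mul_pos hx h
      have := mul_nonneg hy.le hr
      linarith
    · rw [← h] at hpr ⊢
      have := mul_pos hy (by linarith : 0 < r)
      linarith
  have hM := hm.trans hlt
  -- X and Y are recovered from P and R by (M - m)X = MP + mR and (M - m)Y = P + R.
  have qX : ∀ u, (M - m) * qf (L X) u = M * qf (L P) u + m * qf (L R) u := by
    intro u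
    simp only [hP, hR, map_sub, map_smul, qf_sub, qf_smul]; ring
  have qY : ∀ u, (M - m) * qf (L Y) u = qf (L P) u + qf (L R) u := by
    intro u
    simp only [hP, hR, map_sub, map_smul, qf_sub, qf_smul]; ring
  have bd : ∀ u, (a * p * qf 1 u ≤ qf (L P) u ∧ qf (L P) u ≤ b * p * qf 1 u) ∧
      (a * r * qf 1 u ≤ qf (L R) u ∧ qf (L R) u ≤ b * r * qf 1 u) := by
    intro u
    refine ⟨⟨?_, ?_⟩, ?_, ?_⟩
    · simpa [qf_smul] using qf_mono (hl P hP0) u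
    · simpa [qf_smul] using qf_mono (hu P hP0) u
    · simpa [qf_smul] using qf_mono (hl R hR0) u
    · simpa [qf_smul] using qf_mono (hu R hR0) u
  -- On each vector the ratio of L X to L Y is a weighted mean of M and m with weights L P and L R.
  -- The extreme weights allowed by `bd` are (ap, br) and (bp, ar), which give the two constants.
  refine (hilbertDist_le hn hLX hLY (m := (M * a * p + m * b * r) / (a * p + b * r))
    (M := (M * b * p + m * a * r) / (b * p + a * r)) ?_ ?_ ?_).trans
    (log_ratio_le ha hab hp hr hpr hm hmM)
  · exact div_pos (pos (mul_pos hM ha) (mul_pos hm hb)) (pos ha hb)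
  · rw [le_iff_qf (isHermitian_real_smul hLY.isHermitian _) hLX.isHermitian]
    intro u
    obtain ⟨⟨b1, b2⟩, b3, b4⟩ := bd u
    rw [qf_smul, div_mul_eq_mul_div, div_le_iff₀ (pos ha hb)]
    refine le_of_mul_le_mul_left ?_ (sub_pos.2 hlt)
    have e1 : (M - m) * ((M * a * p + m * b * r) * qf (L Y) u) =
      (M * a * p + m * b * r) * ((M - m) * qf (L Y) u) := by ring
    have e2 : (M - m) * (qf (L X) u * (a * p + b * r)) =
      (a * p + b * r) * ((M - m) * qf (L X) u) := by ring
    rw [e1, e2, qX, qY]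
    have k1 := mul_le_mul_of_nonneg_left b1 (mul_nonneg hb.le hr)
    have k2 := mul_le_mul_of_nonneg_left b4 (mul_nonneg ha.le hp)
    have k3 : a * p * qf (L R) u ≤ b * r * qf (L P) u := by linarith
    have := mul_le_mul_of_nonneg_left k3 (sub_pos.2 hlt).le
    linarith
  · rw [le_iff_qf hLX.isHermitian (isHermitian_real_smul hLY.isHermitian _)]
    intro u
    obtain ⟨⟨b1, b2⟩, b3, b4⟩ := bd u
    rw [qf_smul, div_mul_eq_mul_div, le_div_iff₀ (pos hb ha)]
    refine le_of_mul_le_mul_left ?_ (sub_pos.2 hlt)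
    have e1 : (M - m) * ((M * b * p + m * a * r) * qf (L Y) u) =
      (M * b * p + m * a * r) * ((M - m) * qf (L Y) u) := by ring
    have e2 : (M - m) * (qf (L X) u * (b * p + a * r)) =
      (b * p + a * r) * ((M - m) * qf (L X) u) := by ring
    rw [e1, e2, qX, qY]
    have k1 := mul_le_mul_of_nonneg_left b2 (mul_nonneg ha.le hr)
    have k2 := mul_le_mul_of_nonneg_left b3 (mul_nonneg hb.le hp)
    have k3 : a * r * qf (L P) u ≤ b * p * qf (L R) u := by linarith
    have := mul_le_mul_of_nonneg_left k3 (sub_pos.2 hlt).le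
    linarith

end Birkhoff

/-! ### Two-sided bounds for the channel and its dual -/

section Channel

variable {n k : ℕ} (A : Fin k → Matrix (Fin n) (Fin n) ℂ)

theorem Q_add (X Y : Matrix (Fin n) (Fin n) ℂ) : Q A (X + Y) = Q A X + Q A Y := by
  simp [Q, mul_add, add_mul, Finset.sum_add_distrib]

theorem Q_smul (r : ℝ) (X : Matrix (Fin n) (Fin n) ℂ) : Q A (r • X) = r • Q A X := by
  simp [Q, Finset.smul_sum]

theorem Qdual_add (X Y : Matrix (Fin n) (Fin n) ℂ) :
    Qdual A (X + Y) = Qdual A X + Qdual A Y := by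
  simp [Qdual, mul_add, add_mul, Finset.sum_add_distrib]

theorem Qdual_smul (r : ℝ) (X : Matrix (Fin n) (Fin n) ℂ) : Qdual A (r • X) = r • Qdual A X := by
  simp [Qdual, Finset.smul_sum]

/-- `Q` as a real linear map. -/
noncomputable def QLinear : Matrix (Fin n) (Fin n) ℂ →ₗ[ℝ] Matrix (Fin n) (Fin n) ℂ where
  toFun := Q A
  map_add' := Q_add A
  map_smul' := Q_smul A

/-- `Q'` as a real linear map. -/
noncomputable def QdualLinear : Matrix (Fin n) (Fin n) ℂ →ₗ[ℝ] Matrix (Fin n) (Fin n) ℂ where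
  toFun := Qdual A
  map_add' := Qdual_add A
  map_smul' := Qdual_smul A

theorem Q_nonneg {X : Matrix (Fin n) (Fin n) ℂ} (hX : 0 ≤ X) : 0 ≤ Q A X :=
  Finset.sum_nonneg fun i _ => (hX.posSemidef.mul_mul_conjTranspose_same (A i)).nonneg

theorem Q_mono {X Y : Matrix (Fin n) (Fin n) ℂ} (h : X ≤ Y) : Q A X ≤ Q A Y := by
  rw [← sub_nonneg]
  have := Q_nonneg A (sub_nonneg.2 h)
  rwa [show Q A (Y - X) = Q A Y - Q A X from (QLinear A).map_sub Y X] at this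

theorem Qdual_nonneg {X : Matrix (Fin n) (Fin n) ℂ} (hX : 0 ≤ X) : 0 ≤ Qdual A X :=
  Finset.sum_nonneg fun i _ => (hX.posSemidef.conjTranspose_mul_mul_same (A i)).nonneg

theorem trace_Qdual_mul (X W : Matrix (Fin n) (Fin n) ℂ) :
    (Qdual A X * W).trace = (X * Q A W).trace := by
  simp only [Qdual, Q, Finset.sum_mul, Finset.mul_sum, trace_sum]
  refine Finset.sum_congr rfl fun i _ => ?_
  rw [mul_assoc, mul_assoc, trace_mul_comm, mul_assoc, mul_assoc]

/-- Writing X = C*C turns the trace into that of C W C*, which is positive semidefinite. -/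
theorem re_trace_mul_nonneg {X W : Matrix (Fin n) (Fin n) ℂ} (hX : 0 ≤ X) (hW : 0 ≤ W) :
    0 ≤ (X * W).trace.re := by
  obtain ⟨C, rfl⟩ := CStarAlgebra.nonneg_iff_eq_star_mul_self.mp hX
  rw [mul_assoc, trace_mul_comm, star_eq_conjTranspose]
  exact (Complex.le_def.1 (hW.posSemidef.mul_mul_conjTranspose_same C).trace_nonneg).1

theorem re_trace_mul_vecMulVec (X : Matrix (Fin n) (Fin n) ℂ) (u : Fin n → ℂ) :
    (X * vecMulVec u (star u)).trace.re = qf X u := by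
  rw [mul_vecMulVec, trace_vecMulVec, dotProduct_comm, qf]

theorem isClosed_density : IsClosed (density n) := by
  have := orderClosedTopology_matrix (n := n)
  have h1 : IsClosed {X : Matrix (Fin n) (Fin n) ℂ | 0 ≤ X} := isClosed_Ici
  have h2 : IsClosed {X : Matrix (Fin n) (Fin n) ℂ | X.trace = 1} :=
    isClosed_eq continuous_id.matrix_trace continuous_const
  convert h1.inter h2 using 1
  ext X
  simp [density, nonneg_iff_posSemidef]

open scoped Matrix.Norms.L2Operator in
theorem isCompact_density : IsCompact (density n) := by
  have : ProperSpace (Matrix (Fin n) (Fin n) ℂ) := FiniteDimensional.proper ℂ _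
  refine Metric.isCompact_of_isClosed_isBounded isClosed_density ?_
  refine (Metric.isBounded_closedBall (x := (0 : Matrix (Fin n) (Fin n) ℂ)) (r := 1)).subset ?_
  intro X hX
  have h0 := hX.1.nonneg
  rw [mem_closedBall_zero_iff]
  refine norm_le_of_le hX.1.1 zero_le_one ?_ ?_
  · simpa using le_one_of_trace_eq_one h0 (by rw [hX.2, Complex.one_re])
  · exact le_trans (by simp) h0

theorem trace_unif (hn : 0 < n) : (unif n).trace = 1 := by
  have : (n : ℂ) ≠ 0 := by exact_mod_cast hn.ne'
  simp [unif, this]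

theorem unif_eq : unif n = (n : ℝ)⁻¹ • 1 := by
  ext i j
  simp [unif, Matrix.smul_apply]

theorem posDef_unif (hn : 0 < n) : (unif n).PosDef := by
  rw [unif_eq]
  exact posDef_real_smul PosDef.one (by positivity)

theorem unif_mem_density (hn : 0 < n) : unif n ∈ density n :=
  ⟨(posDef_unif hn).posSemidef, trace_unif hn⟩

variable {A}

open scoped Matrix.Norms.L2Operator in
-- The inverse of Q(X) is continuous on the compact set of density matrices, so its norm is bounded
-- by some C there; inverting back gives a uniform lower bound on Q(X).
theorem exists_smul_one_le_Q (hpos : IsPositive A) :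
    ∃ ε : ℝ, 0 < ε ∧ ∀ X ∈ density n, ε • 1 ≤ Q A X := by
  have hc : ContinuousOn (fun X => (Q A X)⁻¹) (density n) := by
    intro X hX
    have hu := (isUnit_iff_isUnit_det _).1 (hpos X hX).isUnit
    have h1 : ContinuousAt (Inv.inv : Matrix (Fin n) (Fin n) ℂ → _) (Q A X) := by
      refine continuousAt_matrix_inv _ ?_
      obtain ⟨x, hx⟩ := hu
      rw [← hx]
      exact NormedRing.inverse_continuousAt x
    have h2 : Continuous (Q A) := by
      unfold Q
      fun_prop
    exact (ContinuousAt.comp (f := Q A) h1 h2.continuousAt).continuousWithinAt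
  obtain ⟨C, hC⟩ := isCompact_density.exists_bound_of_continuousOn hc
  refine ⟨(max C 1)⁻¹, by positivity, fun X hX => ?_⟩
  have hC1 : 0 < max C 1 := by positivity
  have hP := hpos X hX
  have h := le_smul_one_of_norm_le hP.inv.isHermitian ((hC X hX).trans (le_max_left C 1))
  have := inv_le_inv_of_le hP.inv h
  rwa [inv_real_smul hC1.ne' PosDef.one, inv_one,
    nonsing_inv_nonsing_inv _ ((isUnit_iff_isUnit_det _).1 hP.isUnit)] at this

open scoped Matrix.Norms.L2Operator in
theorem exists_Q_le : ∃ C : ℝ, ∀ X ∈ density n, Q A X ≤ C • 1 := by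
  refine ⟨‖Q A 1‖, fun X hX => ?_⟩
  have h1 : X ≤ 1 := le_one_of_trace_eq_one hX.1.nonneg (by rw [hX.2, Complex.one_re])
  exact (Q_mono A h1).trans
    (le_smul_one_of_norm_le (Q_nonneg A zero_le_one).posSemidef.1 le_rfl)

theorem aConst_pos (hn : 0 < n) (hpos : IsPositive A) : 0 < aConst A := by
  obtain ⟨ε, hε, h⟩ := exists_smul_one_le_Q hpos
  refine lt_of_lt_of_le hε (le_csInf (Set.Nonempty.image _ ⟨_, unif_mem_density hn⟩) ?_)
  rintro _ ⟨X, hX, rfl⟩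
  exact le_lamMin hn (hpos X hX).isHermitian (h X hX)

theorem aConst_smul_one_le (hn : 0 < n) (hpos : IsPositive A) {X : Matrix (Fin n) (Fin n) ℂ}
    (hX : X ∈ density n) : aConst A • 1 ≤ Q A X := by
  refine le_trans (smul_le_smul_of_nonneg_right ?_ zero_le_one)
    (lamMin_smul_one_le (hpos X hX).isHermitian)
  refine csInf_le ⟨0, ?_⟩ ⟨X, hX, rfl⟩
  rintro _ ⟨Y, hY, rfl⟩
  exact (lamMin_pos hn (hpos Y hY)).le

theorem Q_le_bConst_smul_one (hn : 0 < n) (hpos : IsPositive A) {X : Matrix (Fin n) (Fin n) ℂ}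
    (hX : X ∈ density n) : Q A X ≤ bConst A • 1 := by
  refine le_trans (le_lamMax_smul_one (hpos X hX).isHermitian)
    (smul_le_smul_of_nonneg_right ?_ zero_le_one)
  obtain ⟨C, hC⟩ := exists_Q_le (A := A)
  refine le_csSup ⟨C, ?_⟩ ⟨X, hX, rfl⟩
  rintro _ ⟨Y, hY, rfl⟩
  exact lamMax_le hn (hpos Y hY).isHermitian (hC Y hY)

theorem aConst_le_bConst (hn : 0 < n) (hpos : IsPositive A) : aConst A ≤ bConst A := by
  have hu := unif_mem_density hn
  have h := (aConst_smul_one_le hn hpos hu).trans (Q_le_bConst_smul_one hn hpos hu)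
  have h1 := re_trace_mono h
  have : (0 : ℝ) < n := by exact_mod_cast hn
  simp only [trace_smul, trace_one, Fintype.card_fin, Complex.smul_re, Complex.natCast_re,
    smul_eq_mul] at h1
  exact le_of_mul_le_mul_right h1 this

theorem kappa_nonneg (hn : 0 < n) (hpos : IsPositive A) : 0 ≤ kappa A := by
  have h1 := aConst_pos hn hpos
  have h2 := aConst_le_bConst hn hpos
  exact div_nonneg (by linarith) (by linarith)

theorem kappa_lt_one (hn : 0 < n) (hpos : IsPositive A) : kappa A < 1 := by
  have h1 := aConst_pos hn hpos
  have h2 := aConst_le_bConst hn hpos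
  rw [kappa, div_lt_one (by linarith)]
  linarith

theorem exists_eq_smul_density {X : Matrix (Fin n) (Fin n) ℂ} (hX : 0 ≤ X)
    (h : X.trace.re ≠ 0) : ∃ D ∈ density n, X = X.trace.re • D := by
  have h0 := re_trace_mono hX
  rw [trace_zero, Complex.zero_re] at h0
  refine ⟨X.trace.re⁻¹ • X, ⟨hX.posSemidef.smul (inv_nonneg.2 h0), ?_⟩, ?_⟩
  · rw [trace_smul, trace_eq_re hX.posSemidef.1]
    simp [h]
  · rw [smul_smul, mul_inv_cancel₀ h, one_smul]

theorem Q_bounds (hn : 0 < n) (hpos : IsPositive A) {X : Matrix (Fin n) (Fin n) ℂ}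
    (hX : 0 ≤ X) : (aConst A * X.trace.re) • 1 ≤ Q A X ∧ Q A X ≤ (bConst A * X.trace.re) • 1 := by
  have h0 := re_trace_mono hX
  rw [trace_zero, Complex.zero_re] at h0
  rcases eq_or_ne X.trace.re 0 with h | h
  · have : X = 0 := by
      rw [← hX.posSemidef.trace_eq_zero_iff, trace_eq_re hX.posSemidef.1, h, Complex.ofReal_zero]
    subst this
    simp [Q]
  · obtain ⟨D, hD, e⟩ := exists_eq_smul_density hX h
    have e2 : Q A X = X.trace.re • Q A D := by rw [← Q_smul, ← e]
    rw [e2, mul_comm, mul_comm (bConst A), mul_smul, mul_smul]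
    exact ⟨smul_le_smul_of_nonneg_left (aConst_smul_one_le hn hpos hD) h0,
      smul_le_smul_of_nonneg_left (Q_le_bConst_smul_one hn hpos hD) h0⟩

/-- By duality the form of Q'(X) at u is tr(X Q(uu*)). The bounds on Q(uu*), paired with X ≥ 0, give
Q' the same constants as Q. -/
theorem Qdual_bounds (hn : 0 < n) (hpos : IsPositive A) {X : Matrix (Fin n) (Fin n) ℂ}
    (hX : 0 ≤ X) :
    (aConst A * X.trace.re) • 1 ≤ Qdual A X ∧ Qdual A X ≤ (bConst A * X.trace.re) • 1 := by
  have hH := (Qdual_nonneg A hX).posSemidef.1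
  have key : ∀ u, aConst A * X.trace.re * qf 1 u ≤ qf (Qdual A X) u ∧
      qf (Qdual A X) u ≤ bConst A * X.trace.re * qf 1 u := by
    intro u
    have hV : (0 : Matrix (Fin n) (Fin n) ℂ) ≤ vecMulVec u (star u) :=
      (posSemidef_vecMulVec_self_star u).nonneg
    have ht : (vecMulVec u (star u)).trace.re = qf 1 u := by
      rw [← re_trace_mul_vecMulVec, one_mul]
    obtain ⟨h1, h2⟩ := Q_bounds hn hpos hV
    have e1 := re_trace_mul_nonneg hX (sub_nonneg.2 h1)
    have e2 := re_trace_mul_nonneg hX (sub_nonneg.2 h2)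
    simp only [mul_sub, trace_sub, Complex.sub_re, mul_smul_comm, mul_one, trace_smul,
      Complex.smul_re, smul_eq_mul, ← trace_Qdual_mul, ht, re_trace_mul_vecMulVec] at e1 e2
    constructor <;> linarith
  have h1 : ∀ r : ℝ, (r • (1 : Matrix (Fin n) (Fin n) ℂ)).IsHermitian :=
    isHermitian_real_smul isHermitian_one
  rw [le_iff_qf (h1 _) hH, le_iff_qf hH (h1 _)]
  simp only [qf_smul]
  exact ⟨fun u => (key u).1, fun u => (key u).2⟩

theorem posDef_Q (hn : 0 < n) (hpos : IsPositive A) {X : Matrix (Fin n) (Fin n) ℂ}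
    (hX : X.PosDef) : (Q A X).PosDef :=
  PosDef.of_le (posDef_real_smul PosDef.one (mul_pos (aConst_pos hn hpos) (re_trace_pos hn hX)))
    (Q_bounds hn hpos hX.posSemidef.nonneg).1

theorem posDef_Qdual (hn : 0 < n) (hpos : IsPositive A) {X : Matrix (Fin n) (Fin n) ℂ}
    (hX : X.PosDef) : (Qdual A X).PosDef :=
  PosDef.of_le (posDef_real_smul PosDef.one (mul_pos (aConst_pos hn hpos) (re_trace_pos hn hX)))
    (Qdual_bounds hn hpos hX.posSemidef.nonneg).1

theorem inv_trace_smul {X : Matrix (Fin n) (Fin n) ℂ} {t : ℂ} (ht : t = (t.re : ℂ)) :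
    t⁻¹ • X = t.re⁻¹ • X := by
  ext i j
  rw [Matrix.smul_apply, Matrix.smul_apply, ht]
  simp

theorem Qtilde_eq (hn : 0 < n) (hpos : IsPositive A) {X : Matrix (Fin n) (Fin n) ℂ}
    (hX : X.PosDef) : ∃ c : ℝ, 0 < c ∧ Qtilde A X = c • Qdual A X := by
  have h := posDef_Qdual hn hpos hX
  exact ⟨_, inv_pos.2 (re_trace_pos hn h), inv_trace_smul (trace_eq_re h.isHermitian)⟩

theorem posDef_Qtilde (hn : 0 < n) (hpos : IsPositive A) {X : Matrix (Fin n) (Fin n) ℂ}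
    (hX : X.PosDef) : (Qtilde A X).PosDef := by
  obtain ⟨c, hc, h⟩ := Qtilde_eq hn hpos hX
  rw [h]
  exact posDef_real_smul (posDef_Qdual hn hpos hX) hc

theorem hilbertDist_Q_le (hn : 0 < n) (hpos : IsPositive A) {X Y : Matrix (Fin n) (Fin n) ℂ}
    (hX : X.PosDef) (hY : Y.PosDef) :
    hilbertDist (Q A X) (Q A Y) ≤ kappa A * hilbertDist X Y :=
  hilbertDist_map_le hn (QLinear A) (aConst_pos hn hpos) (aConst_le_bConst hn hpos)
    (fun _ h => (Q_bounds hn hpos h).1) (fun _ h => (Q_bounds hn hpos h).2) hX hY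
    (posDef_Q hn hpos hX) (posDef_Q hn hpos hY)

theorem hilbertDist_Qtilde_le (hn : 0 < n) (hpos : IsPositive A)
    {X Y : Matrix (Fin n) (Fin n) ℂ} (hX : X.PosDef) (hY : Y.PosDef) :
    hilbertDist (Qtilde A X) (Qtilde A Y) ≤ kappa A * hilbertDist X Y := by
  obtain ⟨c, hc, h⟩ := Qtilde_eq hn hpos hX
  obtain ⟨d, hd, h'⟩ := Qtilde_eq hn hpos hY
  have hQX := posDef_Qdual hn hpos hX
  have hQY := posDef_Qdual hn hpos hY
  rw [h, h', hilbertDist_smul_left hn hQX (posDef_real_smul hQY hd) hc,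
    hilbertDist_smul_right hn hQX hQY hd]
  exact hilbertDist_map_le hn (QdualLinear A) (aConst_pos hn hpos) (aConst_le_bConst hn hpos)
    (fun _ h => (Qdual_bounds hn hpos h).1) (fun _ h => (Qdual_bounds hn hpos h).2) hX hY
    hQX hQY

end Channel

/-! ### The normalizations D_α -/

section Normalization

variable {n : ℕ} {X Y α : Matrix (Fin n) (Fin n) ℂ}

theorem posDef_inv_sqrt (hX : X.PosDef) : ((CFC.sqrt X)⁻¹).PosDef :=
  (posDef_sqrt hX).inv

theorem inv_sqrt_mul_self (hX : X.PosDef) : (CFC.sqrt X)⁻¹ * (CFC.sqrt X)⁻¹ = X⁻¹ := by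
  rw [← Matrix.mul_inv_rev, CFC.sqrt_mul_sqrt_self X hX.posSemidef.nonneg]

theorem inv_sqrt_conj_mono (hX : X.PosDef) {B C : Matrix (Fin n) (Fin n) ℂ} (h : B ≤ C) :
    (CFC.sqrt X)⁻¹ * B * (CFC.sqrt X)⁻¹ ≤ (CFC.sqrt X)⁻¹ * C * (CFC.sqrt X)⁻¹ := by
  have := conjTranspose_mul_mul_le h (CFC.sqrt X)⁻¹
  rwa [(posDef_inv_sqrt hX).isHermitian.eq] at this

theorem posDef_inv_sqrt_conj (hX : X.PosDef) (hα : α.PosDef) :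
    ((CFC.sqrt X)⁻¹ * α * (CFC.sqrt X)⁻¹).PosDef := by
  have hS := posDef_inv_sqrt hX
  have := (IsUnit.posDef_star_left_conjugate_iff hS.isUnit (x := α)).2 hα
  rwa [star_eq_conjTranspose, hS.isHermitian.eq] at this

theorem trace_inv_mul (hX : X.PosDef) :
    (X⁻¹ * α).trace = ((CFC.sqrt X)⁻¹ * α * (CFC.sqrt X)⁻¹).trace := by
  rw [trace_mul_comm _ (CFC.sqrt X)⁻¹, ← mul_assoc, inv_sqrt_mul_self hX]

theorem D_eq (hn : 0 < n) (hX : X.PosDef) (hα : α.PosDef) :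
    ∃ c : ℝ, 0 < c ∧ D α X = c • ((CFC.sqrt X)⁻¹ * α * (CFC.sqrt X)⁻¹) := by
  have h := posDef_inv_sqrt_conj hX hα
  refine ⟨_, inv_pos.2 (re_trace_pos hn h), ?_⟩
  rw [D, trace_inv_mul hX]
  exact inv_trace_smul (trace_eq_re h.isHermitian)

theorem posDef_D (hn : 0 < n) (hX : X.PosDef) (hα : α.PosDef) : (D α X).PosDef := by
  obtain ⟨c, hc, h⟩ := D_eq hn hX hα
  rw [h]
  exact posDef_real_smul (posDef_inv_sqrt_conj hX hα) hc

theorem D_mem_densityPD (hn : 0 < n) (hX : X.PosDef) (hα : α.PosDef) : D α X ∈ densityPD n := by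
  refine ⟨posDef_D hn hX hα, ?_⟩
  have h := re_trace_pos hn (posDef_inv_sqrt_conj hX hα)
  rw [D, trace_inv_mul hX, trace_smul, smul_eq_mul, inv_mul_cancel₀]
  intro h0
  rw [h0, Complex.zero_re] at h
  exact h.false

theorem hilbertDist_D (hn : 0 < n) (hX : X.PosDef) (hY : Y.PosDef) (hα : α.PosDef)
    {β : Matrix (Fin n) (Fin n) ℂ} (hβ : β.PosDef) :
    hilbertDist (D α X) (D β Y) = hilbertDist ((CFC.sqrt X)⁻¹ * α * (CFC.sqrt X)⁻¹)
      ((CFC.sqrt Y)⁻¹ * β * (CFC.sqrt Y)⁻¹) := by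
  obtain ⟨c, hc, h⟩ := D_eq hn hX hα
  obtain ⟨d, hd, h'⟩ := D_eq hn hY hβ
  have h1 := posDef_inv_sqrt_conj hX hα
  have h2 := posDef_inv_sqrt_conj hY hβ
  rw [h, h', hilbertDist_smul_left hn h1 (posDef_real_smul h2 hd) hc,
    hilbertDist_smul_right hn h1 h2 hd]

theorem coe_smul_one (t : ℝ) :
    ((t : ℂ) • 1 : Matrix (Fin n) (Fin n) ℂ) = t • 1 := by
  ext i j
  simp [Matrix.smul_apply]

/-- For α = tI the matrix D_α(X) is a positive multiple of X⁻¹, and both scaling and inversion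
preserve the metric. -/
theorem hilbertDist_D_smul_one (hn : 0 < n) (hX : X.PosDef) (hY : Y.PosDef) {t : ℝ} (ht : 0 < t) :
    hilbertDist (D (t • 1) X) (D (t • 1) Y) = hilbertDist X Y := by
  have h1 : (t • 1 : Matrix (Fin n) (Fin n) ℂ).PosDef := posDef_real_smul PosDef.one ht
  rw [hilbertDist_D hn hX hY h1 h1]
  simp only [mul_smul_comm, mul_one, smul_mul_assoc, inv_sqrt_mul_self hX, inv_sqrt_mul_self hY]
  rw [hilbertDist_smul_left hn hX.inv (posDef_real_smul hY.inv ht) ht,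
    hilbertDist_smul_right hn hX.inv hY.inv ht, hilbertDist_inv hn hX hY]

end Normalization

/-! ### D_α for α near the uniform density -/

section Perturbation

variable {n : ℕ} {α : Matrix (Fin n) (Fin n) ℂ}

/-- `α` is within `t` of the uniform density matrix, in the Loewner order. -/
def Near (α : Matrix (Fin n) (Fin n) ℂ) (t : ℝ) : Prop :=
  α.IsHermitian ∧ ((n : ℝ)⁻¹ - t) • 1 ≤ α ∧ α ≤ ((n : ℝ)⁻¹ + t) • 1

theorem Near.posDef {t : ℝ} (h : Near α t) (ht : t < (n : ℝ)⁻¹) : α.PosDef :=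
  PosDef.of_le (posDef_real_smul PosDef.one (sub_pos.2 ht)) h.2.1

theorem near_unif {t : ℝ} (ht : 0 ≤ t) : Near (unif n) t := by
  rw [unif_eq]
  exact ⟨isHermitian_real_smul isHermitian_one _,
    smul_le_smul_of_nonneg_right (by linarith) zero_le_one,
    smul_le_smul_of_nonneg_right (by linarith) zero_le_one⟩

open scoped Matrix.Norms.L2Operator in
-- With α = I/n + δ, the I/n part of RαR - SαS is nonpositive because R² ≤ S². The δ part has norm
-- at most 2d²tη, since ‖S - R‖ ≤ ηd, and is absorbed by SαS ≥ (c/2n) I. The error carries the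
-- factor η, which measures how far R is from S; this is what later yields a Lipschitz bound rather
-- than an additive one.
theorem conj_le_smul_conj {S R : Matrix (Fin n) (Fin n) ℂ} {c d t η : ℝ} (hn : 0 < n)
    (hc : 0 < c) (hd : 0 ≤ d) (ht : 0 ≤ t) (ht' : t ≤ (n : ℝ)⁻¹ / 2) (hη : 0 ≤ η)
    (hα : Near α t) (hS0 : 0 ≤ S) (hR0 : 0 ≤ R) (hSc : c • 1 ≤ S * S) (hSd : S ≤ d • 1)
    (hRS : R * R ≤ S * S) (hSR : (1 - η) • S ≤ R) :
    R * α * R ≤ (1 + 4 * d ^ 2 / c * n * t * η) • (S * α * S) := by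
  have hn0 : (0 : ℝ) < n := by exact_mod_cast hn
  have hSH : Sᴴ = S := hS0.posSemidef.1
  have hRH : Rᴴ = R := hR0.posSemidef.1
  have hle : R ≤ S := le_of_sq_le_sq hR0 hS0 hRS
  have hRd := hle.trans hSd
  have hzero : ∀ {r : ℝ}, 0 ≤ r → -(r • (1 : Matrix (Fin n) (Fin n) ℂ)) ≤ 0 := fun hr =>
    neg_nonpos.2 (smul_nonneg hr zero_le_one)
  have nS : ‖S‖ ≤ d := norm_le_of_le hSH hd hSd ((hzero hd).trans hS0)
  have nR : ‖R‖ ≤ d := norm_le_of_le hRH hd hRd ((hzero hd).trans hR0)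
  set E := S - R with hE
  have hE0 : 0 ≤ E := sub_nonneg.2 hle
  have hEη : E ≤ (η * d) • 1 := by
    have h1 : E ≤ η • S := by
      rw [sub_smul, one_smul, sub_le_iff_le_add] at hSR
      rwa [hE, sub_le_iff_le_add, add_comm]
    rw [mul_smul]
    exact h1.trans (smul_le_smul_of_nonneg_left hSd hη)
  have hηd := mul_nonneg hη hd
  have nE : ‖E‖ ≤ η * d := norm_le_of_le hE0.posSemidef.1 hηd hEη ((hzero hηd).trans hE0)
  set δ := α - (n : ℝ)⁻¹ • 1 with hδ
  have hδH : δ.IsHermitian := hα.1.sub (isHermitian_real_smul isHermitian_one _)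
  have nδ : ‖δ‖ ≤ t := by
    refine norm_le_of_le hδH ht ?_ ?_
    · have := hα.2.2
      rw [add_smul] at this
      rw [hδ, sub_le_iff_le_add, add_comm]
      exact this
    · have := hα.2.1
      rw [sub_smul, sub_le_iff_le_add] at this
      rw [hδ, neg_le_sub_iff_le_add]
      exact this
  have hWH : (R * δ * R - S * δ * S).IsHermitian := by
    have h1 := isHermitian_conjTranspose_mul_mul R hδH
    have h2 := isHermitian_conjTranspose_mul_mul S hδH
    rw [hRH] at h1
    rw [hSH] at h2
    exact h1.sub h2
  have nW : ‖R * δ * R - S * δ * S‖ ≤ 2 * d ^ 2 * t * η := by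
    have e : R * δ * R - S * δ * S = -(E * δ * S + R * δ * E) := by
      rw [hE]; noncomm_ring
    rw [e, norm_neg]
    have h1 : ‖E * δ * S‖ ≤ η * d * t * d :=
      (norm_mul_le _ _).trans (mul_le_mul ((norm_mul_le _ _).trans
        (mul_le_mul nE nδ (norm_nonneg _) hηd)) nS (norm_nonneg _) (mul_nonneg hηd ht))
    have h2 : ‖R * δ * E‖ ≤ d * t * (η * d) :=
      (norm_mul_le _ _).trans (mul_le_mul ((norm_mul_le _ _).trans
        (mul_le_mul nR nδ (norm_nonneg _) hd)) nE (norm_nonneg _) (mul_nonneg hd ht))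
    have := norm_add_le (E * δ * S) (R * δ * E)
    linarith
  have hW := le_smul_one_of_norm_le hWH nW
  have hlow : (c / (2 * n)) • 1 ≤ S * α * S := by
    have h1 : ((n : ℝ)⁻¹ / 2) • 1 ≤ α :=
      (smul_le_smul_of_nonneg_right (by linarith) zero_le_one).trans hα.2.1
    have h2 := conjTranspose_mul_mul_le h1 S
    rw [hSH, mul_smul_comm, mul_one, smul_mul_assoc] at h2
    refine le_trans ?_ h2
    have h3 := smul_le_smul_of_nonneg_left hSc (by positivity : 0 ≤ (n : ℝ)⁻¹ / 2)
    rw [smul_smul] at h3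
    convert h3 using 2
    field_simp
  have hlow' : (1 : Matrix (Fin n) (Fin n) ℂ) ≤ (c / (2 * n))⁻¹ • (S * α * S) :=
    le_inv_smul_of_smul_le (by positivity) hlow
  have hα' : α = (n : ℝ)⁻¹ • 1 + δ := by rw [hδ]; abel
  have e1 : R * α * R = (n : ℝ)⁻¹ • (R * R) + R * δ * R := by
    rw [hα']; simp [mul_add, add_mul]
  have e2 : S * α * S = (n : ℝ)⁻¹ • (S * S) + S * δ * S := by
    rw [hα']; simp [mul_add, add_mul]
  have h1 : R * α * R ≤ S * α * S + (2 * d ^ 2 * t * η) • 1 := by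
    have h3 := smul_le_smul_of_nonneg_left hRS (by positivity : 0 ≤ (n : ℝ)⁻¹)
    have h4 := add_le_add h3 (sub_le_iff_le_add.1 hW)
    rw [e1, e2]
    refine h4.trans (le_of_eq ?_)
    abel
  refine h1.trans ?_
  rw [add_smul, one_smul]
  refine add_le_add le_rfl ?_
  have h5 := smul_le_smul_of_nonneg_left hlow' (by positivity : 0 ≤ 2 * d ^ 2 * t * η)
  rw [smul_smul] at h5
  convert h5 using 2
  field_simp
  ring

theorem inv_sqrt_conj_le {X Y : Matrix (Fin n) (Fin n) ℂ} {c d t m M : ℝ} (hn : 0 < n)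
    (hc : 0 < c) (hd : 0 < d) (ht : 0 ≤ t) (ht' : t ≤ (n : ℝ)⁻¹ / 2)
    (hα : Near α t) (hX : X.PosDef) (hY : Y.PosDef) (hcY : c • 1 ≤ Y) (hYd : Y ≤ d • 1)
    (hm : 0 < m) (hmM : m ≤ M) (h1 : m • Y ≤ X) (h2 : X ≤ M • Y) :
    (CFC.sqrt X)⁻¹ * α * (CFC.sqrt X)⁻¹ ≤
      (m⁻¹ * (1 + 4 * (d / c) * n * t * (1 - √(m / M)))) •
        ((CFC.sqrt Y)⁻¹ * α * (CFC.sqrt Y)⁻¹) := by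
  have hM := hm.trans_le hmM
  have hSX := posDef_inv_sqrt hX
  have hSY := posDef_inv_sqrt hY
  have hmMs : √(m / M) * √(m / M) = m / M := Real.mul_self_sqrt (by positivity)
  have i1 := inv_le_inv_of_le (posDef_real_smul hY hm) h1
  have i2 := inv_le_inv_of_le hX h2
  rw [inv_real_smul hm.ne' hY] at i1
  rw [inv_real_smul hM.ne' hY] at i2
  have i3 : d⁻¹ • 1 ≤ Y⁻¹ := by
    have := inv_le_inv_of_le hY hYd
    rwa [inv_real_smul hd.ne' PosDef.one, inv_one] at this
  have i4 : Y⁻¹ ≤ c⁻¹ • 1 := by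
    have := inv_le_inv_of_le (posDef_real_smul PosDef.one hc) hcY
    rwa [inv_real_smul hc.ne' PosDef.one, inv_one] at this
  have hss : √m * √m = m := Real.mul_self_sqrt hm.le
  -- From mY ≤ X ≤ MY one gets (m/M) Y⁻¹ ≤ m X⁻¹ ≤ Y⁻¹. Root monotonicity turns the left inequality
  -- into √(m/M) S ≤ R, hence the choice of η.
  have key := conj_le_smul_conj (S := (CFC.sqrt Y)⁻¹) (R := √m • (CFC.sqrt X)⁻¹) (c := d⁻¹)
    (d := √c⁻¹) (η := 1 - √(m / M)) hn (inv_pos.2 hd) (Real.sqrt_nonneg _) ht ht'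
    (sub_nonneg.2 (Real.sqrt_le_one.2 (div_le_one_of_le₀ hmM hM.le))) hα
    hSY.posSemidef.nonneg (smul_nonneg (Real.sqrt_nonneg _) hSX.posSemidef.nonneg)
    (by rwa [inv_sqrt_mul_self hY]) ?_ ?_ ?_
  · have e : (√m • (CFC.sqrt X)⁻¹) * α * (√m • (CFC.sqrt X)⁻¹) =
        m • ((CFC.sqrt X)⁻¹ * α * (CFC.sqrt X)⁻¹) := by
      rw [smul_mul_assoc, smul_mul_smul_comm, hss]
    rw [e] at key
    have := le_inv_smul_of_smul_le hm key
    rw [smul_smul, Real.sq_sqrt (by positivity)] at this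
    convert this using 4
    field_simp
  · refine le_of_sq_le_sq hSY.posSemidef.nonneg (smul_nonneg (Real.sqrt_nonneg _) zero_le_one) ?_
    rw [inv_sqrt_mul_self hY, smul_mul_smul_comm, mul_one, Real.mul_self_sqrt (by positivity)]
    exact i4
  · rw [smul_mul_smul_comm, hss, inv_sqrt_mul_self hX, inv_sqrt_mul_self hY]
    have := smul_le_smul_of_nonneg_left i1 hm.le
    rwa [smul_smul, mul_inv_cancel₀ hm.ne', one_smul] at this
  · rw [sub_sub_cancel]
    refine le_of_sq_le_sq (smul_nonneg (Real.sqrt_nonneg _) hSY.posSemidef.nonneg)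
      (smul_nonneg (Real.sqrt_nonneg _) hSX.posSemidef.nonneg) ?_
    rw [smul_mul_smul_comm, smul_mul_smul_comm, hss, hmMs, inv_sqrt_mul_self hX,
      inv_sqrt_mul_self hY]
    have := smul_le_smul_of_nonneg_left i2 hm.le
    rwa [smul_smul, ← div_eq_mul_inv] at this

/-- For `α` near the uniform density, `D_α` almost preserves the Hilbert metric. -/
theorem hilbertDist_D_le {X Y : Matrix (Fin n) (Fin n) ℂ} {c d t : ℝ} (hn : 0 < n)
    (hc : 0 < c) (hd : 0 < d) (ht : 0 ≤ t) (ht' : t ≤ (n : ℝ)⁻¹ / 2) (hα : Near α t)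
    (hcX : c • 1 ≤ X) (hXd : X ≤ d • 1) (hcY : c • 1 ≤ Y) (hYd : Y ≤ d • 1) :
    hilbertDist (D α X) (D α Y) ≤ (1 + 4 * (d / c) * n * t) * hilbertDist X Y := by
  have hn0 : (0 : ℝ) < n := by exact_mod_cast hn
  have hX := PosDef.of_le (posDef_real_smul PosDef.one hc) hcX
  have hY := PosDef.of_le (posDef_real_smul PosDef.one hc) hcY
  have hαP : α.PosDef := hα.posDef (by have := inv_pos.2 hn0; linarith)
  obtain ⟨m, M, hm, hmM, h1, h2, h⟩ := exists_hilbertDist_eq hn hX hY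
  have hM := hm.trans_le hmM
  have g1 := inv_sqrt_conj_le hn hc hd ht ht' hα hX hY hcY hYd hm hmM h1 h2
  -- Exchanging X and Y replaces (m, M) by (1/M, 1/m), which leaves m/M and therefore η unchanged.
  have g2 := inv_sqrt_conj_le hn hc hd ht ht' hα hY hX hcX hXd (inv_pos.2 hM)
    (inv_anti₀ hm hmM) (inv_smul_le_of_le_smul hM h2) (le_inv_smul_of_smul_le hm h1)
  rw [inv_inv, inv_div_inv] at g2
  set θ := 4 * (d / c) * n * t with hθ
  have hθ0 : 0 ≤ θ := by positivity
  set η := 1 - √(m / M) with hη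
  have hη0 : 0 ≤ η := sub_nonneg.2 (Real.sqrt_le_one.2 (div_le_one_of_le₀ hmM hM.le))
  have hpos : 0 < 1 + θ * η := by positivity
  rw [hilbertDist_D hn hX hY hαP hαP]
  have := hilbertDist_le hn (posDef_inv_sqrt_conj hX hαP) (posDef_inv_sqrt_conj hY hαP)
    (inv_pos.2 (mul_pos hM hpos)) (inv_smul_le_of_le_smul (mul_pos hM hpos) g2) g1
  refine this.trans ?_
  rw [h, Real.log_mul (inv_pos.2 hm).ne' hpos.ne', Real.log_inv, Real.log_inv,
    Real.log_mul hM.ne' hpos.ne']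
  have l1 : Real.log (1 + θ * η) ≤ θ * η := by
    have := Real.log_le_sub_one_of_pos hpos
    linarith
  -- This is 1 - e^(-s) ≤ s with s half the distance. The error factor enters both comparison
  -- constants, so the two halves add up to θ times the distance.
  have l2 : η ≤ (Real.log M - Real.log m) / 2 := by
    have hs : 0 < √(m / M) := Real.sqrt_pos.2 (by positivity)
    have := Real.one_sub_inv_le_log_of_pos (inv_pos.2 hs)
    rw [inv_inv, Real.log_inv, Real.log_sqrt (by positivity), Real.log_div hm.ne' hM.ne'] at this
    linarith
  have l3 := mul_le_mul_of_nonneg_left l2 hθ0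
  linarith

/-- Conjugating the bounds on α by X^(-1/2) compares D_α(X) with X⁻¹, to which D at the uniform
density is proportional. The bound does not depend on X. -/
theorem hilbertDist_D_unif_le {X : Matrix (Fin n) (Fin n) ℂ} {t : ℝ} (hn : 0 < n)
    (ht' : t < (n : ℝ)⁻¹) (hα : Near α t) (hX : X.PosDef) :
    hilbertDist (D α X) (D (unif n) X) ≤
      Real.log ((n : ℝ)⁻¹ + t) - Real.log ((n : ℝ)⁻¹ - t) := by
  have hαP := hα.posDef ht'
  rw [hilbertDist_D hn hX hX hαP (posDef_unif hn), unif_eq, mul_smul_comm, mul_one,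
    smul_mul_assoc, inv_sqrt_mul_self hX,
    hilbertDist_smul_right hn (posDef_inv_sqrt_conj hX hαP) hX.inv (by positivity)]
  refine hilbertDist_le hn (posDef_inv_sqrt_conj hX hαP) hX.inv (sub_pos.2 ht') ?_ ?_
  · simpa [inv_sqrt_mul_self hX] using inv_sqrt_conj_mono hX hα.2.1
  · simpa [inv_sqrt_mul_self hX] using inv_sqrt_conj_mono hX hα.2.2

end Perturbation

/-! ### Fixed points of Hilbert-metric contractions -/

section FixedPoint

variable {n : ℕ}

theorem densityPD_subset_density : densityPD n ⊆ density n := fun _ hX => ⟨hX.1.posSemidef, hX.2⟩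

/-- Equal traces force m ≤ 1 ≤ M, so -log m and log M are each at most the distance. -/
theorem exp_hilbertDist_bounds (hn : 0 < n) {X Y : Matrix (Fin n) (Fin n) ℂ}
    (hX : X ∈ densityPD n) (hY : Y ∈ densityPD n) :
    Real.exp (-hilbertDist X Y) • Y ≤ X ∧ X ≤ Real.exp (hilbertDist X Y) • Y := by
  obtain ⟨m, M, hm, hmM, h1, h2, h⟩ := exists_hilbertDist_eq hn hX.1 hY.1
  have hM := hm.trans_le hmM
  have t1 := re_trace_mono h1
  have t2 := re_trace_mono h2
  simp only [trace_smul, hX.2, hY.2, Complex.smul_re, Complex.one_re, smul_eq_mul, mul_one]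
    at t1 t2
  have l1 := Real.log_nonpos hm.le t1
  have l2 := Real.log_nonneg t2
  refine ⟨(smul_le_smul_of_nonneg_right ?_ hY.1.posSemidef.nonneg).trans h1,
    h2.trans (smul_le_smul_of_nonneg_right ?_ hY.1.posSemidef.nonneg)⟩
  · rw [← Real.le_log_iff_exp_le hm]
    linarith
  · rw [← Real.log_le_iff_le_exp hM]
    linarith

theorem sub_bounds_of_hilbertDist_le (hn : 0 < n) {X Y : Matrix (Fin n) (Fin n) ℂ}
    (hX : X ∈ densityPD n) (hY : Y ∈ densityPD n) {d : ℝ} (h : hilbertDist X Y ≤ d) :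
    X - Y ≤ (Real.exp d - 1) • 1 ∧ -((Real.exp d - 1) • 1) ≤ X - Y := by
  obtain ⟨h1, h2⟩ := exp_hilbertDist_bounds hn hX hY
  have hY0 := hY.1.posSemidef.nonneg
  have hY1 : Y ≤ 1 := le_one_of_trace_eq_one hY0 (by rw [hY.2, Complex.one_re])
  have hd : 0 ≤ d := (hilbertDist_nonneg hn hX.1 hY.1).trans h
  have he : 0 ≤ Real.exp d - 1 := sub_nonneg.2 (Real.one_le_exp hd)
  have k := smul_le_smul_of_nonneg_left hY1 he
  constructor
  · rw [sub_le_iff_le_add]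
    refine h2.trans ((smul_le_smul_of_nonneg_right (Real.exp_le_exp.2 h) hY0).trans ?_)
    rw [← sub_le_iff_le_add]
    simpa [sub_smul] using k
  -- Uses e^d + e^(-d) ≥ 2.
  · have h3 : (1 - (Real.exp d - 1)) • Y ≤ X := by
      refine (smul_le_smul_of_nonneg_right ?_ hY0).trans h1
      have e1 : Real.exp (-d) ≤ Real.exp (-hilbertDist X Y) := Real.exp_le_exp.2 (by linarith)
      have e2 : Real.exp (-d) * Real.exp d = 1 := by rw [← Real.exp_add]; simp
      have e3 := Real.exp_pos (-d)
      have e4 := Real.exp_pos d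
      nlinarith [mul_nonneg he he, mul_nonneg e3.le (mul_nonneg he he)]
    rw [neg_le_sub_iff_le_add, ← sub_le_iff_le_add]
    refine le_trans ?_ h3
    have e : (1 - (Real.exp d - 1)) • Y = Y - (Real.exp d - 1) • Y := by rw [sub_smul, one_smul]
    rw [e]
    exact sub_le_sub_left k _

theorem eq_of_hilbertDist_nonpos (hn : 0 < n) {X Y : Matrix (Fin n) (Fin n) ℂ}
    (hX : X ∈ densityPD n) (hY : Y ∈ densityPD n) (h : hilbertDist X Y ≤ 0) : X = Y := by
  obtain ⟨h1, h2⟩ := sub_bounds_of_hilbertDist_le hn hX hY h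
  rw [Real.exp_zero, sub_self, zero_smul] at h1 h2
  rw [neg_zero] at h2
  exact sub_eq_zero.1 (le_antisymm h1 h2)

theorem tendsto_of_hilbertDist (hn : 0 < n) {x : ℕ → Matrix (Fin n) (Fin n) ℂ}
    {F : Matrix (Fin n) (Fin n) ℂ} (hx : ∀ j, x j ∈ densityPD n) (hF : F ∈ densityPD n)
    {r : ℕ → ℝ} (hr : Tendsto r atTop (𝓝 0)) (h : ∀ j, hilbertDist (x j) F ≤ r j) :
    Tendsto x atTop (𝓝 F) := by
  open scoped Matrix.Norms.L2Operator in
  have key : ∀ j, ‖x j - F‖ ≤ Real.exp (r j) - 1 := by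
    intro j
    obtain ⟨h1, h2⟩ := sub_bounds_of_hilbertDist_le hn (hx j) hF (h j)
    have h0 := (hilbertDist_nonneg hn (hx j).1 hF.1).trans (h j)
    exact norm_le_of_le ((hx j).1.isHermitian.sub hF.1.isHermitian)
      (sub_nonneg.2 (Real.one_le_exp h0)) h1 h2
  have hlim : Tendsto (fun j => Real.exp (r j) - 1) atTop (𝓝 0) := by
    have := ((Real.continuous_exp.tendsto 0).comp hr).sub_const 1
    simpa using this
  exact tendsto_iff_norm_sub_tendsto_zero.2
    (squeeze_zero (fun _ => norm_nonneg _) key hlim)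

/-- A contraction of the Hilbert metric on density matrices has a unique fixed point, and its
iterates converge to it. -/
theorem exists_fixedPoint (hn : 0 < n)
    {T : Matrix (Fin n) (Fin n) ℂ → Matrix (Fin n) (Fin n) ℂ} {q : ℝ} (hq0 : 0 ≤ q) (hq1 : q < 1)
    (hT : Set.MapsTo T (density n) (densityPD n))
    (hc : ∀ X ∈ densityPD n, ∀ Y ∈ densityPD n,
      hilbertDist (T X) (T Y) ≤ q * hilbertDist X Y) :
    ∃ U ∈ densityPD n, T U = U ∧ (∀ V ∈ density n, T V = V → V = U) ∧
      ∀ X ∈ density n, Tendsto (fun m : ℕ => T^[m] X) atTop (𝓝 U) := by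
  have huniq : ∀ U ∈ density n, ∀ V ∈ density n, T U = U → T V = V → V = U := by
    intro U hU V hV eU eV
    have hU' : U ∈ densityPD n := eU ▸ hT hU
    have hV' : V ∈ densityPD n := eV ▸ hT hV
    have h := hc V hV' U hU'
    rw [eU, eV] at h
    have h0 := hilbertDist_nonneg hn hV'.1 hU'.1
    exact eq_of_hilbertDist_nonpos hn hV' hU' (by nlinarith)
  have hconv : ∀ X ∈ density n, ∃ U ∈ densityPD n, T U = U ∧
      Tendsto (fun m : ℕ => T^[m] X) atTop (𝓝 U) := by
    intro X hX
    -- The orbit starts at T X because X itself may be singular.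
    set x : ℕ → Matrix (Fin n) (Fin n) ℂ := fun j => T^[j + 1] X with hxdef
    have hsucc : ∀ j, x (j + 1) = T (x j) := fun j => Function.iterate_succ_apply' T (j + 1) X
    have hx : ∀ j, x j ∈ densityPD n := by
      intro j
      induction j with
      | zero => exact hT hX
      | succ j ih =>
        rw [hsucc]
        exact hT (densityPD_subset_density ih)
    set d := hilbertDist (x 1) (x 0) with hd
    have hd0 : 0 ≤ d := hilbertDist_nonneg hn (hx 1).1 (hx 0).1
    have hstep : ∀ j, hilbertDist (x (j + 1)) (x j) ≤ q ^ j * d := by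
      intro j
      induction j with
      | zero => simp [hd]
      | succ j ih =>
        have h1 := hc _ (hx (j + 1)) _ (hx j)
        rw [← hsucc, ← hsucc] at h1
        refine h1.trans ?_
        rw [pow_succ', mul_assoc]
        exact mul_le_mul_of_nonneg_left ih hq0
    have h1q : 0 < 1 - q := sub_pos.2 hq1
    -- The tail of the geometric series ∑ q^j d, so that the step bounds telescope.
    set r : ℕ → ℝ := fun j => q ^ j * (d / (1 - q)) with hr
    have hsum : ∀ j i, hilbertDist (x (j + i)) (x j) ≤ r j - r (j + i) := by
      intro j i
      induction i with
      | zero =>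
        have := hilbertDist_le hn (hx j).1 (hx j).1 one_pos (M := 1) (by simp) (by simp)
        simpa using this
      | succ i ih =>
        have h2 := hilbertDist_triangle hn (hx (j + i + 1)).1 (hx (j + i)).1 (hx j).1
        have h3 := hstep (j + i)
        have h4 : r (j + i) - r (j + i + 1) = q ^ (j + i) * d := by
          simp only [hr, pow_succ]
          field_simp
        rw [← add_assoc]
        linarith
    have hr0 : ∀ j, 0 ≤ r j := fun j => by
      have := div_nonneg hd0 h1q.le
      simp only [hr]; positivity
    have hrlim : Tendsto r atTop (𝓝 0) := by
      have := (tendsto_pow_atTop_nhds_zero_of_lt_one hq0 hq1).mul_const (d / (1 - q))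
      simpa using this
    have : FirstCountableTopology (Matrix (Fin n) (Fin n) ℂ) :=
      inferInstanceAs (FirstCountableTopology (Fin n → Fin n → ℂ))
    obtain ⟨F, hF, φ, hφ, hlim⟩ := isCompact_density.tendsto_subseq
      (fun j => densityPD_subset_density (hx j))
    have := orderClosedTopology_matrix (n := n)
    have hev : ∀ j, ∀ᶠ i in atTop, Real.exp (-r j) • x j ≤ (x ∘ φ) i ∧
        (x ∘ φ) i ≤ Real.exp (r j) • x j := by
      intro j
      filter_upwards [eventually_ge_atTop j] with i hi
      obtain ⟨l, hl⟩ := Nat.exists_eq_add_of_le (hi.trans hφ.le_apply)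
      have h1 := hsum j l
      rw [← hl] at h1
      have h2 := hr0 (φ i)
      obtain ⟨b1, b2⟩ := exp_hilbertDist_bounds hn (hx (φ i)) (hx j)
      have hj := (hx j).1.posSemidef.nonneg
      exact ⟨(smul_le_smul_of_nonneg_right (Real.exp_le_exp.2 (by linarith)) hj).trans b1,
        b2.trans (smul_le_smul_of_nonneg_right (Real.exp_le_exp.2 (by linarith)) hj)⟩
    -- A priori the limit point F is only semidefinite; the closed order bounds pass to the limit
    -- and make it positive definite.
    have hlow : ∀ j, Real.exp (-r j) • x j ≤ F := fun j =>
      ge_of_tendsto hlim ((hev j).mono fun _ h => h.1)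
    have hup : ∀ j, F ≤ Real.exp (r j) • x j := fun j =>
      le_of_tendsto hlim ((hev j).mono fun _ h => h.2)
    have hFP : F ∈ densityPD n :=
      ⟨PosDef.of_le (posDef_real_smul (hx 0).1 (Real.exp_pos _)) (hlow 0), hF.2⟩
    have hdist : ∀ j, hilbertDist (x j) F ≤ 2 * r j := by
      intro j
      rw [hilbertDist_comm hn (hx j).1 hFP.1]
      have := hilbertDist_le hn hFP.1 (hx j).1 (Real.exp_pos _) (hlow j) (hup j)
      rw [Real.log_exp, Real.log_exp] at this
      linarith
    have hTF : T F ∈ densityPD n := hT hF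
    -- The contraction estimate against the orbit replaces any continuity of T.
    have hfix : hilbertDist (T F) F ≤ 0 := by
      have hle : ∀ j, hilbertDist (T F) F ≤ 2 * r j + 2 * r (j + 1) := by
        intro j
        have h1 := hilbertDist_triangle hn hTF.1 (hx (j + 1)).1 hFP.1
        have h2 := hc F hFP _ (hx j)
        rw [← hsucc, hilbertDist_comm hn hFP.1 (hx j).1] at h2
        have h3 := hdist j
        have h4 := hdist (j + 1)
        have h5 := hilbertDist_nonneg hn (hx j).1 hFP.1
        have h6 := mul_le_of_le_one_left h5 hq1.le
        linarith
      have hl : Tendsto (fun j => 2 * r j + 2 * r (j + 1)) atTop (𝓝 0) := by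
        have := (hrlim.const_mul 2).add (((tendsto_add_atTop_iff_nat 1).2 hrlim).const_mul 2)
        simpa using this
      exact ge_of_tendsto' hl hle
    refine ⟨F, hFP, eq_of_hilbertDist_nonpos hn hTF hFP hfix, ?_⟩
    have h2r : Tendsto (fun j => 2 * r j) atTop (𝓝 0) := by simpa using hrlim.const_mul 2
    exact (tendsto_add_atTop_iff_nat 1).1 (tendsto_of_hilbertDist hn hx hFP h2r hdist)
  obtain ⟨U, hU, eU, -⟩ := hconv _ (unif_mem_density hn)
  have hU' := densityPD_subset_density hU
  refine ⟨U, hU, eU, fun V hV eV => huniq U hU' V hV eU eV, fun X hX => ?_⟩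
  obtain ⟨U₂, hU₂, eU₂, hlim⟩ := hconv X hX
  rwa [huniq U hU' U₂ (densityPD_subset_density hU₂) eU eU₂] at hlim

end FixedPoint

/-! ### Frobenius balls and the relative interior -/

section Frobenius

variable {n : ℕ}

open scoped Matrix.Norms.Frobenius in
theorem frobenius_norm_sq (H : Matrix (Fin n) (Fin n) ℂ) : ‖H‖ ^ 2 = (Hᴴ * H).trace.re := by
  have h0 : 0 ≤ ∑ i, ∑ j, ‖H i j‖ ^ (2 : ℝ) :=
    Finset.sum_nonneg fun i _ => Finset.sum_nonneg fun j _ => by positivity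
  rw [frobenius_norm_def, ← Real.sqrt_eq_rpow, Real.sq_sqrt h0, Finset.sum_comm]
  simp only [trace, diag_apply, mul_apply, conjTranspose_apply, Complex.re_sum]
  refine Finset.sum_congr rfl fun i _ => Finset.sum_congr rfl fun j _ => ?_
  rw [Real.rpow_two, ← Complex.normSq_eq_norm_sq, Complex.star_def, ← Complex.normSq_eq_conj_mul_self,
    Complex.ofReal_re]

/-- The largest eigenvalue of H*H is at most its trace. -/
theorem norm_l2_le_frobenius (H : Matrix (Fin n) (Fin n) ℂ) :
    @norm _ Matrix.instL2OpNormedAddCommGroup.toNorm H ≤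
      @norm _ Matrix.frobeniusNormedAddCommGroup.toNorm H := by
  open scoped Matrix.Norms.L2Operator in
  have h0 : 0 ≤ Hᴴ * H := (posSemidef_conjTranspose_mul_self H).nonneg
  have h1 := le_trace_smul_one h0
  rw [← frobenius_norm_sq, ← Algebra.algebraMap_eq_smul_one,
    ← CStarAlgebra.norm_le_iff_le_algebraMap _ (sq_nonneg _) h0, ← star_eq_conjTranspose,
    CStarRing.norm_star_mul_self, ← sq] at h1
  exact abs_le_of_sq_le_sq' h1 (@norm_nonneg _
    Matrix.frobeniusNormedAddCommGroup.toSeminormedAddCommGroup.toSeminormedAddGroup H) |>.2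

open scoped Matrix.Norms.Frobenius in
theorem bounds_of_frobenius_norm_le {H : Matrix (Fin n) (Fin n) ℂ} (hH : H.IsHermitian) {t : ℝ}
    (h : ‖H‖ ≤ t) : H ≤ t • 1 ∧ -(t • 1) ≤ H :=
  ⟨le_smul_one_of_norm_le hH ((norm_l2_le_frobenius H).trans h),
    neg_smul_one_le_of_norm_le hH ((norm_l2_le_frobenius H).trans h)⟩

open scoped Matrix.Norms.L2Operator in
theorem conjTranspose_mul_self_le {H : Matrix (Fin n) (Fin n) ℂ} (hH : H.IsHermitian) {t : ℝ}
    (ht : 0 ≤ t) (h1 : H ≤ t • 1) (h2 : -(t • 1) ≤ H) : Hᴴ * H ≤ t ^ 2 • 1 := by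
  have hn := norm_le_of_le hH ht h1 h2
  have h0 : 0 ≤ Hᴴ * H := (posSemidef_conjTranspose_mul_self H).nonneg
  refine le_smul_one_of_norm_le h0.posSemidef.1 ?_
  rw [← star_eq_conjTranspose, CStarRing.norm_star_mul_self, ← sq]
  exact pow_le_pow_left₀ (norm_nonneg _) hn 2

open scoped Matrix.Norms.Frobenius in
theorem frobenius_norm_le_of_le {H : Matrix (Fin n) (Fin n) ℂ} (hH : H.IsHermitian) {t : ℝ}
    (ht : 0 ≤ t) (h1 : H ≤ t • 1) (h2 : -(t • 1) ≤ H) : ‖H‖ ≤ √n * t := by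
  have h3 := re_trace_mono (conjTranspose_mul_self_le hH ht h1 h2)
  rw [← frobenius_norm_sq] at h3
  simp only [trace_smul, trace_one, Fintype.card_fin, Complex.smul_re, Complex.natCast_re,
    smul_eq_mul] at h3
  refine abs_le_of_sq_le_sq' ?_ (by positivity) |>.2
  rw [mul_pow, Real.sq_sqrt (Nat.cast_nonneg n), mul_comm]
  exact h3

theorem near_of_mem_frobBall {α : Matrix (Fin n) (Fin n) ℂ} {t : ℝ}
    (hα : α ∈ frobBall (unif n) t) : Near α t := by
  obtain ⟨hH, -, h⟩ := hα
  have hu : (unif n).IsHermitian := by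
    rw [unif_eq]
    exact isHermitian_real_smul isHermitian_one _
  obtain ⟨h1, h2⟩ := bounds_of_frobenius_norm_le (hH.sub hu) h.le
  rw [unif_eq] at h1 h2
  refine ⟨hH, ?_, ?_⟩
  · rw [sub_smul, sub_le_iff_le_add]
    rwa [neg_le_sub_iff_le_add] at h2
  · rw [add_smul, add_comm]
    rwa [sub_le_iff_le_add] at h1

theorem exists_frobBall_subset (hn : 0 < n) {F : Matrix (Fin n) (Fin n) ℂ}
    (hF : F ∈ densityPD n) : ∃ ε > 0, frobBall F ε ⊆ densityPD n := by
  have hpos := lamMin_pos hn hF.1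
  refine ⟨lamMin F / 2, half_pos hpos, ?_⟩
  rintro X ⟨hX, ht, h⟩
  refine ⟨?_, ht⟩
  have h2 := (bounds_of_frobenius_norm_le (hX.sub hF.1.isHermitian) h.le).2
  rw [neg_le_sub_iff_le_add, ← sub_le_iff_le_add] at h2
  have h3 := lamMin_smul_one_le hF.1.isHermitian
  refine PosDef.of_le (posDef_real_smul PosDef.one (half_pos hpos)) (le_trans ?_ h2)
  refine le_trans ?_ (sub_le_sub_right h3 _)
  rw [← sub_smul]
  exact le_of_eq (by congr 1; ring)

theorem mem_frobBall_of_hilbertDist (hn : 0 < n) {X F : Matrix (Fin n) (Fin n) ℂ}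
    (hX : X ∈ densityPD n) (hF : F ∈ densityPD n) {d ε : ℝ} (h : hilbertDist X F ≤ d)
    (hε : √n * (Real.exp d - 1) < ε) : X ∈ frobBall F ε := by
  obtain ⟨h1, h2⟩ := sub_bounds_of_hilbertDist_le hn hX hF h
  have h0 := (hilbertDist_nonneg hn hX.1 hF.1).trans h
  exact ⟨hX.1.isHermitian, hX.2, (frobenius_norm_le_of_le (hX.1.isHermitian.sub hF.1.isHermitian)
    (sub_nonneg.2 (Real.one_le_exp h0)) h1 h2).trans_lt hε⟩

theorem mem_intrinsicInterior_density (hn : 0 < n) {F : Matrix (Fin n) (Fin n) ℂ}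
    (hF : F ∈ densityPD n) : F ∈ intrinsicInterior ℝ (density n) := by
  obtain ⟨ε, hε, hsub⟩ := exists_frobBall_subset hn hF
  rw [mem_intrinsicInterior]
  refine ⟨⟨F, subset_affineSpan ℝ _ (densityPD_subset_density hF)⟩, ?_, rfl⟩
  -- Being Hermitian of trace one is preserved by affine combinations, so a Frobenius neighbourhood
  -- of F in the affine span lies in `frobBall`.
  have hspan : ∀ X ∈ affineSpan ℝ (density n), X.IsHermitian ∧ X.trace = 1 := by
    intro X hX
    refine affineSpan_induction (p := fun X => X.IsHermitian ∧ X.trace = 1) hX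
      (fun X hX => ⟨hX.1.1, hX.2⟩) fun c u v w hu hv hw => ?_
    simp only [vsub_eq_sub, vadd_eq_add]
    refine ⟨(isHermitian_real_smul (hu.1.sub hv.1) c).add hw.1, ?_⟩
    rw [trace_add, trace_smul, trace_sub, hu.2, hv.2, hw.2]
    simp
  open scoped Matrix.Norms.Frobenius in
  have hcont : Continuous fun X : Matrix (Fin n) (Fin n) ℂ => ‖X - F‖ := by fun_prop
  rw [mem_interior]
  refine ⟨{X | @norm _ Matrix.frobeniusNormedAddCommGroup.toNorm (X.1 - F) < ε}, ?_,
    isOpen_lt (hcont.comp continuous_subtype_val) continuous_const, ?_⟩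
  · intro X hX
    obtain ⟨h1, h2⟩ := hspan X.1 X.2
    exact densityPD_subset_density (hsub ⟨h1, h2, hX⟩)
  · change @norm _ Matrix.frobeniusNormedAddCommGroup.toNorm (F - F) < ε
    rw [sub_self]
    open scoped Matrix.Norms.Frobenius in
    rwa [norm_zero]

end Frobenius

/-! ### Contraction and perturbation estimates for Φ -/

section Bridge

variable {n k : ℕ} {A : Fin k → Matrix (Fin n) (Fin n) ℂ} {α β : Matrix (Fin n) (Fin n) ℂ}

theorem Qtilde_bounds (hn : 0 < n) (hpos : IsPositive A) {X : Matrix (Fin n) (Fin n) ℂ}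
    (hX : X ∈ densityPD n) : (aConst A / (n * bConst A)) • 1 ≤ Qtilde A X ∧
      Qtilde A X ≤ (bConst A / (n * aConst A)) • 1 := by
  have hn0 : (0 : ℝ) < n := by exact_mod_cast hn
  have ha := aConst_pos hn hpos
  have hb := ha.trans_le (aConst_le_bConst hn hpos)
  obtain ⟨h1, h2⟩ := Qdual_bounds hn hpos hX.1.posSemidef.nonneg
  rw [hX.2, Complex.one_re, mul_one] at h1 h2
  have hQ := posDef_Qdual hn hpos hX.1
  have t1 := re_trace_mono h1
  have t2 := re_trace_mono h2
  simp only [trace_smul, trace_one, Fintype.card_fin, Complex.smul_re, Complex.natCast_re,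
    smul_eq_mul] at t1 t2
  have ht := re_trace_pos hn hQ
  have e : Qtilde A X = (Qdual A X).trace.re⁻¹ • Qdual A X :=
    inv_trace_smul (trace_eq_re hQ.isHermitian)
  rw [e]
  constructor
  · refine le_trans ?_ (smul_le_smul_of_nonneg_left h1 (inv_pos.2 ht).le)
    rw [smul_smul]
    refine smul_le_smul_of_nonneg_right ?_ zero_le_one
    rw [div_eq_inv_mul]
    exact mul_le_mul_of_nonneg_right (inv_anti₀ ht (by linarith)) ha.le
  · refine (smul_le_smul_of_nonneg_left h2 (inv_pos.2 ht).le).trans ?_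
    rw [smul_smul]
    refine smul_le_smul_of_nonneg_right ?_ zero_le_one
    rw [div_eq_inv_mul]
    exact mul_le_mul_of_nonneg_right (inv_anti₀ (by positivity) (by linarith)) hb.le

theorem mapsTo_Phi (hn : 0 < n) (hpos : IsPositive A) (hα : α.PosDef) (hβ : β.PosDef) :
    Set.MapsTo (Phi A α β) (density n) (densityPD n) := fun X hX =>
  D_mem_densityPD hn (posDef_Qtilde hn hpos (posDef_D hn (hpos X hX) hβ)) hα

theorem hilbertDist_D_unif (hn : 0 < n) {X Y : Matrix (Fin n) (Fin n) ℂ} (hX : X.PosDef)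
    (hY : Y.PosDef) : hilbertDist (D (unif n) X) (D (unif n) Y) = hilbertDist X Y := by
  rw [unif_eq]
  exact hilbertDist_D_smul_one hn hX hY (by positivity)

theorem hilbertDist_Phi_le {t : ℝ} (hn : 0 < n) (hpos : IsPositive A) (ht : 0 ≤ t)
    (ht' : t ≤ (n : ℝ)⁻¹ / 2) (hα : Near α t) (hβ : Near β t)
    {X Y : Matrix (Fin n) (Fin n) ℂ} (hX : X ∈ densityPD n) (hY : Y ∈ densityPD n) :
    hilbertDist (Phi A α β X) (Phi A α β Y) ≤
      kappa A ^ 2 * (1 + 4 * (bConst A / aConst A) ^ 2 * n * t) ^ 2 * hilbertDist X Y := by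
  have hn0 : (0 : ℝ) < n := by exact_mod_cast hn
  have ha := aConst_pos hn hpos
  have hab := aConst_le_bConst hn hpos
  have hb := ha.trans_le hab
  have hκ := kappa_nonneg hn hpos
  have hβP : β.PosDef := hβ.posDef (by have := inv_pos.2 hn0; linarith)
  set K := 4 * (bConst A / aConst A) ^ 2 * n with hK
  have hK0 : 0 ≤ 1 + K * t := by positivity
  have hQX := posDef_Q hn hpos hX.1
  have hQY := posDef_Q hn hpos hY.1
  have hDX := D_mem_densityPD hn hQX hβP
  have hDY := D_mem_densityPD hn hQY hβP
  have hTX := posDef_Qtilde hn hpos hDX.1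
  have hTY := posDef_Qtilde hn hpos hDY.1
  -- The bound b is weakened to b²/a so that the upper-to-lower ratio is (b/a)², the same as for Q̃;
  -- both D steps then share the constant K.
  have hup : ∀ {Z : Matrix (Fin n) (Fin n) ℂ}, Z ∈ densityPD n →
      Q A Z ≤ (bConst A ^ 2 / aConst A) • 1 := fun hZ =>
    (Q_le_bConst_smul_one hn hpos (densityPD_subset_density hZ)).trans
      (smul_le_smul_of_nonneg_right
        ((le_div_iff₀ ha).2 (by rw [sq]; exact mul_le_mul_of_nonneg_left hab hb.le)) zero_le_one)
  have h1 := hilbertDist_Q_le hn hpos hX.1 hY.1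
  have h2 := hilbertDist_D_le (d := bConst A ^ 2 / aConst A) hn ha (by positivity) ht ht' hβ
    (aConst_smul_one_le hn hpos (densityPD_subset_density hX)) (hup hX)
    (aConst_smul_one_le hn hpos (densityPD_subset_density hY)) (hup hY)
  have e2 : 4 * (bConst A ^ 2 / aConst A / aConst A) * n = K := by rw [hK]; field_simp
  rw [e2] at h2
  have h3 := hilbertDist_Qtilde_le hn hpos hDX.1 hDY.1
  obtain ⟨bX1, bX2⟩ := Qtilde_bounds hn hpos hDX
  obtain ⟨bY1, bY2⟩ := Qtilde_bounds hn hpos hDY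
  have h4 := hilbertDist_D_le hn (by positivity) (by positivity) ht ht' hα bX1 bX2 bY1 bY2
  have e4 : 4 * (bConst A / (n * aConst A) / (aConst A / (n * bConst A))) * n = K := by
    rw [hK]; field_simp
  rw [e4] at h4
  calc hilbertDist (Phi A α β X) (Phi A α β Y)
      ≤ (1 + K * t) * hilbertDist (Qtilde A (D β (Q A X))) (Qtilde A (D β (Q A Y))) := h4
    _ ≤ (1 + K * t) * (kappa A * ((1 + K * t) * (kappa A * hilbertDist X Y))) :=
      mul_le_mul_of_nonneg_left (h3.trans (mul_le_mul_of_nonneg_left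
        (h2.trans (mul_le_mul_of_nonneg_left h1 hK0)) hκ)) hK0
    _ = _ := by ring

theorem hilbertDist_Theta_le (hn : 0 < n) (hpos : IsPositive A)
    {X Y : Matrix (Fin n) (Fin n) ℂ} (hX : X ∈ densityPD n) (hY : Y ∈ densityPD n) :
    hilbertDist (Theta A X) (Theta A Y) ≤ kappa A ^ 2 * hilbertDist X Y := by
  have h := hilbertDist_Phi_le hn hpos le_rfl (by positivity) (near_unif le_rfl)
    (near_unif le_rfl) hX hY
  simpa [Theta] using h

/-- Replacing β and then α by I/n costs one logarithmic term each; the first is not enlarged by Q̃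
or by the isometry D at the uniform density. -/
theorem hilbertDist_Phi_Theta_le {t : ℝ} (hn : 0 < n) (hpos : IsPositive A)
    (ht' : t < (n : ℝ)⁻¹) (hα : Near α t) (hβ : Near β t)
    {X : Matrix (Fin n) (Fin n) ℂ} (hX : X ∈ density n) :
    hilbertDist (Phi A α β X) (Theta A X) ≤
      2 * (Real.log ((n : ℝ)⁻¹ + t) - Real.log ((n : ℝ)⁻¹ - t)) := by
  have hαP := hα.posDef ht'
  have hβP := hβ.posDef ht'
  have hu := posDef_unif hn
  have hQ := hpos X hX
  have hD := posDef_D hn hQ hβP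
  have hD' := posDef_D hn hQ hu
  have hT := posDef_Qtilde hn hpos hD
  have hT' := posDef_Qtilde hn hpos hD'
  have h1 := hilbertDist_D_unif_le hn ht' hβ hQ
  have h2 := hilbertDist_Qtilde_le hn hpos hD hD'
  have h3 := hilbertDist_D_unif_le hn ht' hα hT
  have h4 := hilbertDist_triangle hn (posDef_D hn hT hαP) (posDef_D hn hT hu)
    (posDef_D hn hT' hu)
  rw [hilbertDist_D_unif hn hT hT'] at h4
  have h5 := mul_le_of_le_one_left (hilbertDist_nonneg hn hD hD') (kappa_lt_one hn hpos).le
  have : hilbertDist (Phi A α β X) (Theta A X) = hilbertDist (D α (Qtilde A (D β (Q A X))))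
      (D (unif n) (Qtilde A (D (unif n) (Q A X)))) := rfl
  linarith

/-- A radius that makes all perturbed maps uniform contractions close to `Θ`. -/
theorem exists_radius (hn : 0 < n) (hpos : IsPositive A) {ε : ℝ} (hε : 0 < ε) :
    ∃ q < 1, 0 ≤ q ∧ ∃ t > 0, t ≤ (n : ℝ)⁻¹ / 2 ∧
      kappa A ^ 2 * (1 + 4 * (bConst A / aConst A) ^ 2 * n * t) ^ 2 ≤ q ∧
      √n * (Real.exp (2 * (Real.log ((n : ℝ)⁻¹ + t) - Real.log ((n : ℝ)⁻¹ - t)) / (1 - q)) - 1)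
        < ε := by
  have hn0 : (0 : ℝ) < (n : ℝ)⁻¹ := inv_pos.2 (by exact_mod_cast hn)
  have hκ : kappa A ^ 2 < 1 :=
    pow_lt_one₀ (kappa_nonneg hn hpos) (kappa_lt_one hn hpos) two_ne_zero
  obtain ⟨q, hq, hq1⟩ := exists_between hκ
  refine ⟨q, hq1, (sq_nonneg _).trans hq.le, ?_⟩
  have c1 : ContinuousAt
      (fun t : ℝ => kappa A ^ 2 * (1 + 4 * (bConst A / aConst A) ^ 2 * n * t) ^ 2) 0 := by
    fun_prop
  have c2 : ContinuousAt (fun t : ℝ => √n * (Real.exp (2 * (Real.log ((n : ℝ)⁻¹ + t) -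
      Real.log ((n : ℝ)⁻¹ - t)) / (1 - q)) - 1)) 0 := by
    have l1 : ContinuousAt (fun t : ℝ => Real.log ((n : ℝ)⁻¹ + t)) 0 :=
      ContinuousAt.log (by fun_prop) (by simpa using hn0.ne')
    have l2 : ContinuousAt (fun t : ℝ => Real.log ((n : ℝ)⁻¹ - t)) 0 :=
      ContinuousAt.log (by fun_prop) (by simpa using hn0.ne')
    fun_prop
  -- At t = 0 the two expressions equal κ² < q and 0 < ε, so continuity gives both inequalities for
  -- small t.
  have v1 := c1.eventually_lt_const (u := q) (by simpa using hq)
  have v2 := c2.eventually_lt_const (u := ε) (by simpa using hε)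
  have v3 : ∀ᶠ t : ℝ in 𝓝 0, t < (n : ℝ)⁻¹ / 2 := eventually_lt_nhds (by positivity)
  have hall := ((v1.and (v2.and v3)).filter_mono nhdsWithin_le_nhds).and
    (self_mem_nhdsWithin (a := (0 : ℝ)) (s := Set.Ioi 0))
  obtain ⟨t, ⟨h1, h2, h3⟩, h4⟩ := hall.exists
  exact ⟨t, h4, h3.le, h1.le, h2⟩

end Bridge

end QBridge

theorem theorem5p1 (n k : ℕ) (hn : 0 < n) (A : Fin k → Matrix (Fin n) (Fin n) ℂ)
    (hchan : QBridge.IsChannel A) (hpos : QBridge.IsPositive A) :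
    -- 1: `Q` and `Q̃` are strict contractions on positive definite matrices
    ((0 ≤ QBridge.kappa A ∧ QBridge.kappa A < 1) ∧
      ∀ X Y : Matrix (Fin n) (Fin n) ℂ, X.PosDef → Y.PosDef →
        (QBridge.Q A X).PosDef ∧ (QBridge.Qtilde A X).PosDef ∧
        QBridge.hilbertDist (QBridge.Q A X) (QBridge.Q A Y)
          ≤ QBridge.kappa A * QBridge.hilbertDist X Y ∧
        QBridge.hilbertDist (QBridge.Qtilde A X) (QBridge.Qtilde A Y)
          ≤ QBridge.kappa A * QBridge.hilbertDist X Y) ∧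
    -- 2: `D_{tI}` preserves the Hilbert metric
    (∀ t : ℝ, 0 < t → ∀ X Y : Matrix (Fin n) (Fin n) ℂ, X.PosDef → Y.PosDef →
        (QBridge.D ((t : ℂ) • 1) X).PosDef ∧
        QBridge.hilbertDist (QBridge.D ((t : ℂ) • 1) X) (QBridge.D ((t : ℂ) • 1) Y)
          = QBridge.hilbertDist X Y) ∧
    -- 3: `Θ` is a contraction of the positive definite density matrices
    (Set.MapsTo (QBridge.Theta A) (QBridge.densityPD n) (QBridge.densityPD n) ∧
      ∀ X ∈ QBridge.densityPD n, ∀ Y ∈ QBridge.densityPD n,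
        QBridge.hilbertDist (QBridge.Theta A X) (QBridge.Theta A Y)
          ≤ QBridge.kappa A ^ 2 * QBridge.hilbertDist X Y) ∧
    -- 4: the unique fixed point `F` of `Θ`, which attracts every density matrix
    ∃ F : Matrix (Fin n) (Fin n) ℂ,
      (F ∈ QBridge.densityPD n ∧ F ∈ intrinsicInterior ℝ (QBridge.density n) ∧
        QBridge.Theta A F = F ∧
        (∀ X ∈ QBridge.density n, QBridge.Theta A X = X → X = F) ∧
        ∀ X ∈ QBridge.density n,
          Filter.Tendsto (fun m : ℕ => (QBridge.Theta A)^[m] X) Filter.atTop (nhds F)) ∧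
      -- 5: balls around `I/n` and `F`
      ∃ ε₁ > 0, ∃ ε₂ > 0,
        QBridge.frobBall (QBridge.unif n) ε₁ ⊆ QBridge.densityPD n ∧
        QBridge.frobBall F ε₂ ⊆ QBridge.densityPD n ∧
        ∀ α ∈ QBridge.frobBall (QBridge.unif n) ε₁, ∀ β ∈ QBridge.frobBall (QBridge.unif n) ε₁,
          ∃ U ∈ QBridge.frobBall F ε₂,
            QBridge.Phi A α β U = U ∧
            (∀ V ∈ QBridge.density n, QBridge.Phi A α β V = V → V = U) ∧
            ∀ X ∈ QBridge.frobBall F ε₂,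
              Filter.Tendsto (fun m : ℕ => (QBridge.Phi A α β)^[m] X) Filter.atTop (nhds U) := by
  open QBridge in
  have hn0 : (0 : ℝ) < n := by exact_mod_cast hn
  have hu := posDef_unif hn
  refine ⟨⟨⟨kappa_nonneg hn hpos, kappa_lt_one hn hpos⟩, fun X Y hX hY =>
      ⟨posDef_Q hn hpos hX, posDef_Qtilde hn hpos hX, hilbertDist_Q_le hn hpos hX hY,
        hilbertDist_Qtilde_le hn hpos hX hY⟩⟩, fun t ht X Y hX hY => ?_,
    ⟨fun X hX => mapsTo_Phi hn hpos hu hu (densityPD_subset_density hX),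
      fun X hX Y hY => hilbertDist_Theta_le hn hpos hX hY⟩, ?_⟩
  · rw [coe_smul_one]
    exact ⟨posDef_D hn hX (posDef_real_smul Matrix.PosDef.one ht),
      hilbertDist_D_smul_one hn hX hY ht⟩
  have hκ := kappa_nonneg hn hpos
  obtain ⟨F, hF, eF, uF, lF⟩ := exists_fixedPoint hn (sq_nonneg (kappa A))
    (pow_lt_one₀ hκ (kappa_lt_one hn hpos) two_ne_zero) (mapsTo_Phi hn hpos hu hu)
    (fun X hX Y hY => hilbertDist_Theta_le hn hpos hX hY)
  refine ⟨F, ⟨hF, mem_intrinsicInterior_density hn hF, eF, uF, lF⟩, ?_⟩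
  obtain ⟨ε₂, hε₂, hB₂⟩ := exists_frobBall_subset hn hF
  obtain ⟨q, hq1, hq0, ε₁, hε₁, hν, hcontr, hclose⟩ := exists_radius hn hpos hε₂
  have hν' : ε₁ < (n : ℝ)⁻¹ := by
    have := inv_pos.2 hn0
    linarith
  refine ⟨ε₁, hε₁, ε₂, hε₂, fun α hα => ⟨(near_of_mem_frobBall hα).posDef hν', hα.2.1⟩, hB₂,
    fun α hα β hβ => ?_⟩
  have hα' := near_of_mem_frobBall hα
  have hβ' := near_of_mem_frobBall hβ
  have hc : ∀ X ∈ densityPD n, ∀ Y ∈ densityPD n,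
      hilbertDist (Phi A α β X) (Phi A α β Y) ≤ q * hilbertDist X Y := fun X hX Y hY =>
    (hilbertDist_Phi_le hn hpos hε₁.le hν hα' hβ' hX hY).trans
      (mul_le_mul_of_nonneg_right hcontr (hilbertDist_nonneg hn hX.1 hY.1))
  obtain ⟨U, hU, eU, uU, lU⟩ := exists_fixedPoint hn hq0 hq1
    (mapsTo_Phi hn hpos (hα'.posDef hν') (hβ'.posDef hν')) hc
  refine ⟨U, mem_frobBall_of_hilbertDist hn hU hF ?_ hclose, eU, uU,
    fun X hX => lU X (densityPD_subset_density (hB₂ hX))⟩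
  have hF' := densityPD_subset_density hF
  have hΦF := mapsTo_Phi hn hpos (hα'.posDef hν') (hβ'.posDef hν') hF'
  -- Since ΦU = U and ΘF = F, dist(U, F) ≤ q dist(U, F) + dist(ΦF, ΘF), and solving for dist(U, F)
  -- produces the factor 1/(1 - q).
  have h1 := hilbertDist_triangle hn hU.1 hΦF.1 hF.1
  have h2 := hc U hU F hF
  rw [eU] at h2
  have h3 := hilbertDist_Phi_Theta_le hn hpos hν' hα' hβ' hF'
  rw [show Theta A F = F from eF] at h3
  rw [le_div_iff₀ (sub_pos.2 hq1)]
  linarith
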